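/- For integers $n \ge m \ge 0$ let $S(n,m)$ denote the Stirling number of the second kind (the number of partitions of an $n$-element set into exactly $m$ non-empty blocks) and let $s(n,m)$ denote the signed Stirling number of the first kind, defined by $x(x-1)\cdots(x-n+1)=\sum_{m=0}^n s(n,m)x^m$. For integers $n\ge 3$ and $2\le k\le n$ put $N:=\binom n2$ and \[ \mu=\mu_{n,k}:=\frac{\binom k2\binom n3}{\binom N2},\qquad \tau=\tau_{n,k}:=\frac{13-12k+3k^2}{\binom N2}, \] \[ d_1:=\frac{\binom n3}{\binom N2}+\tau+(1-\tau)\left(\frac{4(k-2)\binom n3}{\binom N2}+\frac{6\binom n4(k-2)}{\binom n3(N-2)}\right), \] \[ d_2:=\frac{2\binom n3}{\binom N2}+\tau+(1-\tau)\left(\frac{8(k-2)\binom n3}{\binom N2}+\frac{6\binom n4(k-2)}{\binom n3(N-2)}+\frac{k-2}{N-2}\cdot\frac{5n-11}{4}\right), \] \[ D^{(1)}_{n,k}:=\min(d_1,\ \mu d_1,\ 1),\qquad D^{(2)}_{n,k}:=\min(d_2,\ 2\mu d_2,\ 1). \] Then for all integers $n\ge 3$ and $2\le k\le n$, \[ \binom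 Nk e^{-2\mu}\left(1-e^{2\mu}D^{(2)}_{n,k}\right)\le S(n,n-k)\le \binom Nk e^{-2\mu}\left(1+e^{2\mu}D^{(2)}_{n,k}\right), \] \[ \binom Nk e^{-\mu}\left(1-e^{\mu}D^{(1)}_{n,k}\right)\le |s(n,n-k)|\le \binom Nk e^{-\mu}\left(1+e^{\mu}D^{(1)}_{n,k}\right). \] Moreover, if $k=k(n)$ is a sequence of integers with $2\le k(n)\le n$ for all sufficiently large $n$ and $k(n)=O(\sqrt n)$ as $n\to\infty$, then the absolute errors $D^{(1)}_{n,k(n)}$ and $D^{(2)}_{n,k(n)}$ and the relative errors $e^{\mu_{n,k(n)}}D^{(1)}_{n,k(n)}$ and $e^{2\mu_{n,k(n)}}D^{(2)}_{n,k(n)}$ all tend to $0$ as $n\to\infty$. -/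

import Mathlib

open Filter Asymptotics Topology

namespace StirlingBound

/-- The signed Stirling number of the first kind `s(n, m)`: the coefficient of `x ^ m` in the
falling factorial `x (x - 1) ⋯ (x - n + 1)`. -/
noncomputable def signedStirlingFirst (n m : ℕ) : ℤ :=
  (descPochhammer ℤ n).coeff m

/-- The relation `s(n, m) = (-1) ^ (n + m) |s(n, m)|` with Mathlib's unsigned Stirling numbers
of the first kind. -/
theorem signedStirlingFirst_eq (n m : ℕ) :
    signedStirlingFirst n m = (-1) ^ (n + m) * (Nat.stirlingFirst n m : ℤ) := by
  unfold signedStirlingFirst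
  induction n generalizing m with
  | zero =>
    cases m with
    | zero => simp
    | succ m => simp [Polynomial.coeff_one]
  | succ n ih =>
    rw [descPochhammer_succ_right, mul_sub, Polynomial.coeff_sub,
      ← Polynomial.C_eq_natCast, Polynomial.coeff_mul_C, ih]
    cases m with
    | zero =>
      cases n with
      | zero => simp
      | succ n => simp
    | succ m =>
      rw [Polynomial.coeff_mul_X, ih, Nat.stirlingFirst_succ_succ]
      push_cast
      ring

theorem abs_signedStirlingFirst (n m : ℕ) :
    |signedStirlingFirst n m| = (Nat.stirlingFirst n m : ℤ) := by
  rw [signedStirlingFirst_eq, abs_mul, abs_pow]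
  simp

/-- The number `N = C(n, 2)` of squares of the staircase board. -/
def boardSize (n : ℕ) : ℕ := n.choose 2

/-- `μ_{n,k} = C(k,2) C(n,3) / C(N,2)`. -/
noncomputable def mu (n k : ℕ) : ℝ :=
  (k.choose 2 : ℝ) * (n.choose 3 : ℝ) / ((boardSize n).choose 2 : ℝ)

/-- The quantity `(13 - 12 k + 3 k²) / C(N,2)`, which occurs twice in each of `d₁`, `d₂`. -/
noncomputable def tau (n k : ℕ) : ℝ :=
  (13 - 12 * (k : ℝ) + 3 * (k : ℝ) ^ 2) / ((boardSize n).choose 2 : ℝ)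

noncomputable def d₁ (n k : ℕ) : ℝ :=
  (n.choose 3 : ℝ) / ((boardSize n).choose 2 : ℝ) + tau n k
    + (1 - tau n k) *
      (4 * ((k : ℝ) - 2) * (n.choose 3 : ℝ) / ((boardSize n).choose 2 : ℝ)
        + 6 * (n.choose 4 : ℝ) * ((k : ℝ) - 2) / ((n.choose 3 : ℝ) * ((boardSize n : ℝ) - 2)))

noncomputable def d₂ (n k : ℕ) : ℝ :=
  2 * (n.choose 3 : ℝ) / ((boardSize n).choose 2 : ℝ) + tau n k
    + (1 - tau n k) *
      (8 * ((k : ℝ) - 2) * (n.choose 3 : ℝ) / ((boardSize n).choose 2 : ℝ)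
        + 6 * (n.choose 4 : ℝ) * ((k : ℝ) - 2) / ((n.choose 3 : ℝ) * ((boardSize n : ℝ) - 2))
        + ((k : ℝ) - 2) / ((boardSize n : ℝ) - 2) * ((5 * (n : ℝ) - 11) / 4))

/-- `D⁽¹⁾_{n,k} = min(d₁, μ d₁, 1)`. -/
noncomputable def D₁ (n k : ℕ) : ℝ :=
  min (d₁ n k) (min (mu n k * d₁ n k) 1)

/-- `D⁽²⁾_{n,k} = min(d₂, 2 μ d₂, 1)`. -/
noncomputable def D₂ (n k : ℕ) : ℝ :=
  min (d₂ n k) (min (2 * mu n k * d₂ n k) 1)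

end StirlingBound

/-!
Stirling numbers count rook placements on the staircase board of squares `(i, j)`, `i < j < n`,
which has `N = C(n, 2)` squares: `S(n, n - k)` is the number of ways to place `k` rooks with no two
in a common row or column (`card_placements_stirlingSecond`), and `|s(n, n - k)|` the number of ways
with no two in a common column (`card_placements_stirlingFirst`). Both satisfy the Stirling
recurrence, by looking at the last column of the board. So each is the number of independent
`k`-sets of a graph on the `N` squares, with `2 C(n, 3)` and `C(n, 3)` edges.

For a graph with `N` vertices, `e` edges and maximal degree at most `Δ`, let `W(T)` be the number of
edges inside a `k`-set `T`, let `G(t)` be the average of `t ^ W(T)` over all `T`, and put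
`p = e / C(N, 2)` and `l = C(k, 2) p`, the mean of `W`. Then `G(1) = 1`, `G(0)` is the proportion of
independent sets, and the proportion is compared with `e⁻ˡ` by means of the differential equation
`G' = l G` of the Poisson distribution. Differentiating, `G'(t)` is `l` times the average of
`t ^ (W(T) - 1)` over the sets `T` containing a random edge, while `G(t)` is the average of
`t ^ W(T)` over the sets `T` containing a random pair. In both cases `T` consists of a pair and of
`k - 2` other vertices `R`, and the exponent is `W(R)` unless the random pair is an edge, which has
probability `p`, or `R` meets the neighbourhood of the pair. Exchanging one pair for the other
matters only if `R` meets a pair. Union bounds give `|G' - l G| ≤ l δ` on `[0, 1]` with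
`δ = p + (k - 2) (2 + 2 Δ) / (N - 2)` (`abs_deriv_sub_mul_le`); the bound with `δ = 1` is trivial.
Integrating `(e^{-l t} G)'` yields `|G(0) - e⁻ˡ| ≤ (1 - e⁻ˡ) δ` (`abs_card_independent_sub_le`).

The degrees are at most `n - 2` and `2 (n - 2)`, and the resulting `δ` are at most `d₁` and `d₂`
whenever these are smaller than `1` (`error_le_d₁_or`, `error_le_d₂_or`), except for `d₂` at
`n = k = 3`, where the Stirling number is zero. The factor `1 - e⁻ˡ ≤ min(1, l)` produces the minima
in `D₁` and `D₂`. The limits follow from `d₁, d₂ ≤ 30 k / n` and from the boundedness of `μ` for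
`k = O(√n)`.
-/

namespace StirlingBound

open Finset

/-! ### Edges inside random vertex sets -/

section Graph

variable {α : Type*} [DecidableEq α]

/-- The number of edges of a graph, given by its set `E` of two-element edges, that lie inside
the vertex set `T`. -/
def edgesIn (E : Finset (Finset α)) (T : Finset α) : ℕ := #{p ∈ E | p ⊆ T}

/-- The vertices of `V` outside `p` that are joined to a vertex of `p`. -/
def outerNeighbors (E : Finset (Finset α)) (V p : Finset α) : Finset α :=
  {v ∈ V \ p | ∃ a ∈ p, {a, v} ∈ E}

theorem sum_edgesIn_mul (E : Finset (Finset α)) (𝒯 : Finset (Finset α)) (f : Finset α → ℝ) :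
    ∑ T ∈ 𝒯, (edgesIn E T : ℝ) * f T = ∑ p ∈ E, ∑ T ∈ 𝒯 with p ⊆ T, f T := by
  simp_rw [edgesIn, Finset.card_filter, Nat.cast_sum, Finset.sum_mul, Finset.sum_filter]
  rw [Finset.sum_comm]
  refine Finset.sum_congr rfl fun p _ => Finset.sum_congr rfl fun T _ => ?_
  split_ifs <;> simp

theorem sum_powersetCard_superset (V p : Finset α) (hp : p ⊆ V) (m : ℕ) (f : Finset α → ℝ) :
    ∑ T ∈ V.powersetCard (m + #p) with p ⊆ T, f T
      = ∑ R ∈ (V \ p).powersetCard m, f (p ∪ R) := by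
  refine Finset.sum_bij' (fun T _ => T \ p) (fun R _ => p ∪ R) ?_ ?_ ?_ ?_ ?_
  · intro T hT
    simp only [mem_filter, mem_powersetCard] at hT ⊢
    obtain ⟨⟨h1, h2⟩, h3⟩ := hT
    exact ⟨sdiff_subset_sdiff h1 le_rfl, by rw [card_sdiff_of_subset h3]; omega⟩
  · intro R hR
    simp only [mem_filter, mem_powersetCard] at hR ⊢
    have hd : Disjoint p R := disjoint_of_subset_right hR.1 disjoint_sdiff
    exact ⟨⟨union_subset hp (hR.1.trans sdiff_subset), by rw [card_union_of_disjoint hd]; omega⟩,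
      subset_union_left⟩
  · intro T hT
    simp only [mem_filter] at hT
    exact union_sdiff_of_subset hT.2
  · intro R hR
    simp only [mem_powersetCard] at hR
    have hd : Disjoint p R := disjoint_of_subset_right hR.1 disjoint_sdiff
    exact union_sdiff_cancel_left hd
  · intro T hT
    simp only [mem_filter] at hT
    rw [union_sdiff_of_subset hT.2]

/-- Union bound: among the `m`-subsets of `S`, the fraction that meet `B` is at most
`|B| m / |S|`. -/
theorem card_powersetCard_not_disjoint_le (S B : Finset α) (hB : B ⊆ S) (m : ℕ) (hS : 0 < #S) :
    (#{R ∈ S.powersetCard m | ¬ Disjoint R B} : ℝ)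
      ≤ #B * ((m : ℝ) / #S * (#S).choose m) := by
  have h1 : ∀ v ∈ B, (#{R ∈ S.powersetCard m | v ∈ R} : ℝ) = (m : ℝ) / #S * (#S).choose m := by
    intro v hv
    rcases m with _ | m
    · simp
    · have h := card_filter_powersetCard_subset {v} S (m + 1)
        (by simpa using hB hv) (by simp)
      simp only [singleton_subset_iff, card_singleton, Nat.add_sub_cancel] at h
      rw [h]
      obtain ⟨s, hs⟩ : ∃ s, #S = s + 1 := ⟨#S - 1, by omega⟩
      rw [hs, Nat.add_sub_cancel]
      have := Nat.add_one_mul_choose_eq s m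
      have h' : ((s : ℝ) + 1) * (s.choose m : ℝ) = ((s + 1).choose (m + 1) : ℝ) * (m + 1) := by
        exact_mod_cast this
      push_cast
      field_simp
      linarith
  have h2 : ({R ∈ S.powersetCard m | ¬ Disjoint R B} : Finset (Finset α))
      ⊆ B.biUnion fun v => {R ∈ S.powersetCard m | v ∈ R} := by
    intro R hR
    simp only [mem_filter, mem_biUnion, not_disjoint_iff] at hR ⊢
    obtain ⟨h, v, hv, hvB⟩ := hR
    exact ⟨v, hvB, h, hv⟩
  calc (#{R ∈ S.powersetCard m | ¬ Disjoint R B} : ℝ)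
      ≤ ∑ v ∈ B, (#{R ∈ S.powersetCard m | v ∈ R} : ℝ) := by
        exact_mod_cast (card_le_card h2).trans card_biUnion_le
    _ = _ := by rw [Finset.sum_congr rfl h1]; simp

theorem card_outerNeighbors_le {E : Finset (Finset α)} {V p : Finset α} {Δ : ℕ}
    (hp : p ∈ V.powersetCard 2) (hΔ : ∀ a ∈ V, #{f ∈ E | a ∈ f} ≤ Δ) :
    #(outerNeighbors E V p) ≤ 2 * Δ := by
  obtain ⟨hpV, hp2⟩ := mem_powersetCard.1 hp
  have h : outerNeighbors E V p ⊆ p.biUnion fun a => {v ∈ V \ p | {a, v} ∈ E} := by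
    intro v hv
    simp only [outerNeighbors, mem_filter, mem_biUnion] at hv ⊢
    obtain ⟨h1, a, ha, h2⟩ := hv
    exact ⟨a, ha, h1, h2⟩
  refine (card_le_card h).trans (card_biUnion_le.trans ?_)
  have : ∀ a ∈ p, #{v ∈ V \ p | {a, v} ∈ E} ≤ Δ := by
    intro a ha
    refine le_trans ?_ (hΔ a (hpV ha))
    refine card_le_card_of_injOn (fun v => {a, v}) ?_ ?_
    · intro v hv
      rw [mem_coe, mem_filter] at hv ⊢
      exact ⟨hv.2, mem_insert_self _ _⟩
    · intro v hv w hw hvw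
      rw [mem_coe, mem_filter, Finset.mem_sdiff] at hv hw
      dsimp only at hvw
      have hva : v ∈ ({a, w} : Finset α) := by rw [← hvw]; simp
      simp only [mem_insert, mem_singleton] at hva
      rcases hva with rfl | h
      · exact absurd ha hv.1.2
      · exact h
  calc _ ≤ ∑ a ∈ p, Δ := Finset.sum_le_sum this
    _ = _ := by simp [hp2]

theorem edgesIn_add_le (E : Finset (Finset α)) (p R : Finset α) (hd : Disjoint p R)
    (hp0 : p.Nonempty) :
    edgesIn E R + (if p ∈ E then 1 else 0) ≤ edgesIn E (p ∪ R) := by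
  unfold edgesIn
  have hsub : ({f ∈ E | f ⊆ R} : Finset (Finset α)) ⊆ {f ∈ E | f ⊆ p ∪ R} := by
    intro f hf
    simp only [mem_filter] at hf ⊢
    exact ⟨hf.1, hf.2.trans subset_union_right⟩
  split_ifs with h
  · have hpn : p ∉ ({f ∈ E | f ⊆ R} : Finset (Finset α)) := by
      simp only [mem_filter, not_and]
      intro _ hpR
      obtain ⟨a, ha⟩ := hp0
      exact disjoint_left.1 hd ha (hpR ha)
    rw [← card_insert_of_notMem hpn]
    refine card_le_card (insert_subset ?_ hsub)
    simp only [mem_filter]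
    exact ⟨h, subset_union_left⟩
  · simpa using card_le_card hsub

/-- If no vertex of `R` is joined to `p`, the edges inside `p ∪ R` are those inside `R` and
possibly `p` itself. -/
theorem edgesIn_union_le {E : Finset (Finset α)} {V p R : Finset α}
    (hE : E ⊆ V.powersetCard 2) (hp : p ∈ V.powersetCard 2) (hR : R ⊆ V \ p)
    (hRd : Disjoint R (outerNeighbors E V p)) :
    edgesIn E (p ∪ R) ≤ edgesIn E R + (if p ∈ E then 1 else 0) := by
  obtain ⟨hpV, hp2⟩ := mem_powersetCard.1 hp
  have key : ∀ f ∈ E, f ⊆ p ∪ R → f ⊆ R ∨ f = p := by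
    intro f hf hfs
    obtain ⟨hfV, hf2⟩ := mem_powersetCard.1 (hE hf)
    by_cases hfp : f ⊆ p
    · exact Or.inr (eq_of_subset_of_card_le hfp (by omega))
    left
    obtain ⟨v, hv, hvp⟩ := not_subset.1 hfp
    have hvR : v ∈ R := (mem_union.1 (hfs hv)).resolve_left hvp
    intro a ha
    rcases mem_union.1 (hfs ha) with hap | haR
    · exfalso
      have hav : a ≠ v := fun h => hvp (h ▸ hap)
      have hfe : {a, v} = f := by
        refine eq_of_subset_of_card_le ?_ ?_
        · intro x hx
          simp only [mem_insert, mem_singleton] at hx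
          rcases hx with rfl | rfl <;> assumption
        · rw [card_pair hav, hf2]
      refine disjoint_left.1 hRd hvR ?_
      simp only [outerNeighbors, mem_filter]
      exact ⟨hR hvR, a, hap, hfe ▸ hf⟩
    · exact haR
  unfold edgesIn
  split_ifs with h
  · rw [Nat.add_comm]
    have : ({f ∈ E | f ⊆ p ∪ R} : Finset (Finset α)) ⊆ insert p {f ∈ E | f ⊆ R} := by
      intro f hf
      simp only [mem_filter, mem_insert] at hf ⊢
      rcases key f hf.1 hf.2 with h | h
      · exact Or.inr ⟨hf.1, h⟩
      · exact Or.inl h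
    exact (card_le_card this).trans ((card_insert_le _ _).trans (by omega))
  · refine card_le_card ?_
    intro f hf
    simp only [mem_filter] at hf ⊢
    rcases key f hf.1 hf.2 with h' | h'
    · exact ⟨hf.1, h'⟩
    · exact absurd (h' ▸ hf.1) h

/-- For `f` with values in `[0, 1]`, replacing `f R` by `0` on the sets `R` that meet `B` changes
the sum over `m`-subsets by at most the number of such sets. -/
theorem sum_powersetCard_le_add (S B : Finset α) (hB : B ⊆ S) (m : ℕ) (hS : 0 < #S)
    (f g : Finset α → ℝ) (hf1 : ∀ R, f R ≤ 1)
    (hfg : ∀ R ∈ S.powersetCard m, Disjoint R B → f R ≤ g R) :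
    ∑ R ∈ S.powersetCard m, f R
      ≤ ∑ R ∈ S.powersetCard m with Disjoint R B, g R
        + #B * ((m : ℝ) / #S * (#S).choose m) := by
  rw [← Finset.sum_filter_add_sum_filter_not (S.powersetCard m) (fun R => Disjoint R B)]
  refine add_le_add ?_ ?_
  · refine Finset.sum_le_sum fun R hR => ?_
    simp only [mem_filter] at hR
    exact hfg R hR.1 hR.2
  · refine le_trans ?_ (card_powersetCard_not_disjoint_le S B hB m hS)
    calc _ ≤ ∑ R ∈ S.powersetCard m with ¬ Disjoint R B, (1 : ℝ) :=
          Finset.sum_le_sum fun R _ => hf1 R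
      _ = _ := by simp

variable {E : Finset (Finset α)} {V : Finset α} {m Δ : ℕ} {t : ℝ}

/-- The sums of `t ^ W` over the `m`-subsets avoiding two given pairs `p`, `q` of vertices are
nearly the same: they differ only in the sets that meet `p ∪ q`. -/
theorem sum_pow_sdiff_le (hV : 3 ≤ #V) (ht0 : 0 ≤ t) (ht1 : t ≤ 1) {p q : Finset α}
    (hp : p ∈ V.powersetCard 2) (hq : q ∈ V.powersetCard 2) :
    ∑ R ∈ (V \ p).powersetCard m, t ^ edgesIn E R
      ≤ ∑ R ∈ (V \ q).powersetCard m, t ^ edgesIn E R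
        + 2 * ((m : ℝ) / ((#V : ℝ) - 2) * (#V - 2).choose m) := by
  obtain ⟨hpV, hp2⟩ := mem_powersetCard.1 hp
  obtain ⟨hqV, hq2⟩ := mem_powersetCard.1 hq
  have hS : #(V \ p) = #V - 2 := by rw [card_sdiff_of_subset hpV, hp2]
  have hSr : (#(V \ p) : ℝ) = (#V : ℝ) - 2 := by
    rw [hS, Nat.cast_sub (by omega)]; norm_num
  have h := sum_powersetCard_le_add (V \ p) (q \ p) (sdiff_subset_sdiff hqV le_rfl) m
    (by omega) (fun R => t ^ edgesIn E R) (fun R => t ^ edgesIn E R)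
    (fun R => pow_le_one₀ ht0 ht1) (fun R _ _ => le_rfl)
  refine h.trans (add_le_add ?_ ?_)
  · refine Finset.sum_le_sum_of_subset_of_nonneg ?_ fun R _ _ => pow_nonneg ht0 _
    intro R hR
    simp only [mem_filter, mem_powersetCard] at hR ⊢
    obtain ⟨⟨h1, h2⟩, h3⟩ := hR
    refine ⟨fun x hx => ?_, h2⟩
    have := h1 hx
    rw [Finset.mem_sdiff] at this ⊢
    refine ⟨this.1, fun hxq => disjoint_left.1 h3 hx ?_⟩
    simp [hxq, this.2]
  · rw [hSr, hS]
    have hc : (#(q \ p) : ℝ) ≤ 2 := by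
      exact_mod_cast (card_le_card sdiff_subset).trans hq2.le
    have h0 : (0 : ℝ) ≤ (#V : ℝ) - 2 := by rw [← hSr]; positivity
    exact mul_le_mul_of_nonneg_right hc (by positivity)

/-- Adding a pair `p` to `R` creates the edge `p`, if it is one, and, unless `R` meets the
neighbourhood of `p`, no further edge. -/
theorem sum_pow_union_bounds (hV : 3 ≤ #V) (hE : E ⊆ V.powersetCard 2)
    (hΔ : ∀ a ∈ V, #{f ∈ E | a ∈ f} ≤ Δ) (ht0 : 0 ≤ t) (ht1 : t ≤ 1) {p : Finset α}
    (hp : p ∈ V.powersetCard 2) :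
    ∑ R ∈ (V \ p).powersetCard m, t ^ (edgesIn E (p ∪ R) - if p ∈ E then 1 else 0)
        ≤ ∑ R ∈ (V \ p).powersetCard m, t ^ edgesIn E R ∧
    ∑ R ∈ (V \ p).powersetCard m, t ^ edgesIn E R
      ≤ ∑ R ∈ (V \ p).powersetCard m, t ^ (edgesIn E (p ∪ R) - if p ∈ E then 1 else 0)
        + 2 * Δ * ((m : ℝ) / ((#V : ℝ) - 2) * (#V - 2).choose m) := by
  obtain ⟨hpV, hp2⟩ := mem_powersetCard.1 hp
  have hS : #(V \ p) = #V - 2 := by rw [card_sdiff_of_subset hpV, hp2]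
  have hSr : (#(V \ p) : ℝ) = (#V : ℝ) - 2 := by
    rw [hS, Nat.cast_sub (by omega)]; norm_num
  have hp0 : p.Nonempty := card_pos.1 (by omega)
  constructor
  · refine Finset.sum_le_sum fun R hR => ?_
    have hd : Disjoint p R :=
      disjoint_of_subset_right (mem_powersetCard.1 hR).1 disjoint_sdiff
    have := edgesIn_add_le E p R hd hp0
    exact pow_le_pow_of_le_one ht0 ht1 (by omega)
  · have h := sum_powersetCard_le_add (V \ p) (outerNeighbors E V p) (filter_subset _ _) m
      (by omega) (fun R => t ^ edgesIn E R)
      (fun R => t ^ (edgesIn E (p ∪ R) - if p ∈ E then 1 else 0))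
      (fun R => pow_le_one₀ ht0 ht1) (fun R hR hRd => by
        have := edgesIn_union_le hE hp (mem_powersetCard.1 hR).1 hRd
        exact pow_le_pow_of_le_one ht0 ht1 (by omega))
    refine h.trans (add_le_add ?_ ?_)
    · exact Finset.sum_le_sum_of_subset_of_nonneg (filter_subset _ _)
        fun R _ _ => pow_nonneg ht0 _
    · rw [hSr, hS]
      have hc : (#(outerNeighbors E V p) : ℝ) ≤ 2 * Δ := by
        exact_mod_cast card_outerNeighbors_le hp hΔ
      have h0 : (0 : ℝ) ≤ (#V : ℝ) - 2 := by rw [← hSr]; positivity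
      exact mul_le_mul_of_nonneg_right hc (by positivity)

/-! ### Poisson approximation for independent sets -/

/-- If `|G' - l G| ≤ l c` on `[0, 1]`, then `G 0` is within `c (1 - e⁻ˡ)` of `e⁻ˡ G 1`; this is
one half of that statement. -/
theorem exp_neg_mul_sub_le_of_deriv_le {G G' : ℝ → ℝ} {l c : ℝ}
    (hG : ∀ t, HasDerivAt G (G' t) t) (h : ∀ t ∈ Set.Icc (0 : ℝ) 1, G' t - l * G t ≤ l * c) :
    Real.exp (-l) * G 1 - G 0 ≤ c * (1 - Real.exp (-l)) := by
  have hd : ∀ t, HasDerivAt (fun t => Real.exp (-l * t) * (G t + c))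
      (Real.exp (-l * t) * (G' t - l * G t - l * c)) t := by
    intro t
    have h1 : HasDerivAt (fun t => Real.exp (-l * t)) (Real.exp (-l * t) * (-l)) t := by
      simpa using ((hasDerivAt_id t).const_mul (-l)).exp
    refine (h1.mul ((hG t).add_const c)).congr_deriv ?_
    ring
  have ha : AntitoneOn (fun t => Real.exp (-l * t) * (G t + c)) (Set.Icc (0 : ℝ) 1) := by
    refine antitoneOn_of_deriv_nonpos (convex_Icc 0 1)
      (fun t _ => (hd t).continuousAt.continuousWithinAt)
      (fun t _ => (hd t).differentiableAt.differentiableWithinAt) fun t ht => ?_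
    rw [(hd t).deriv]
    have := h t (interior_subset ht)
    exact mul_nonpos_of_nonneg_of_nonpos (Real.exp_pos _).le (by linarith)
  have := ha (Set.left_mem_Icc.2 zero_le_one) (Set.right_mem_Icc.2 zero_le_one) zero_le_one
  simp only [mul_one, mul_zero, Real.exp_zero, one_mul] at this
  linarith

theorem abs_sub_exp_neg_mul_le_of_deriv {G G' : ℝ → ℝ} {l c : ℝ}
    (hG : ∀ t, HasDerivAt G (G' t) t) (h : ∀ t ∈ Set.Icc (0 : ℝ) 1, |G' t - l * G t| ≤ l * c) :
    |G 0 - Real.exp (-l) * G 1| ≤ c * (1 - Real.exp (-l)) := by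
  have h1 := exp_neg_mul_sub_le_of_deriv_le hG fun t ht => (abs_le.1 (h t ht)).2
  have h2 := exp_neg_mul_sub_le_of_deriv_le (G := fun t => -G t) (G' := fun t => -G' t)
    (l := l) (c := c) (fun t => (hG t).neg) fun t ht => by
      have := (abs_le.1 (h t ht)).1
      linarith
  rw [abs_le]
  constructor <;> linarith

theorem edgesIn_powersetCard_two {T : Finset α} (hT : T ∈ V.powersetCard (m + 2)) :
    edgesIn (V.powersetCard 2) T = (m + 2).choose 2 := by
  obtain ⟨hTV, hTc⟩ := mem_powersetCard.1 hT
  rw [← hTc, ← card_powersetCard, edgesIn]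
  congr 1
  ext p
  simp only [mem_filter, mem_powersetCard]
  exact ⟨fun h => ⟨h.2, h.1.2⟩, fun h => ⟨⟨h.1.trans hTV, h.2⟩, h.1⟩⟩

/-- The Stein-type identity in generating-function form: if `G(t)` is the sum of `t ^ W(T)` over
all `(m + 2)`-subsets `T` of `V`, with `W(T)` the number of edges inside `T`, then `G'` is close to
`l G`, where `l` is the mean of `W`. -/
theorem abs_deriv_sub_mul_le (hV : 3 ≤ #V) (hE : E ⊆ V.powersetCard 2)
    (hΔ : ∀ a ∈ V, #{f ∈ E | a ∈ f} ≤ Δ) {t : ℝ} (ht : t ∈ Set.Icc (0 : ℝ) 1) {δ : ℝ}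
    (hδ : (#E : ℝ) / (#V).choose 2 + (m : ℝ) / ((#V : ℝ) - 2) * (2 + 2 * Δ) ≤ δ ∨ 1 ≤ δ) :
    |∑ T ∈ V.powersetCard (m + 2), (edgesIn E T : ℝ) * t ^ (edgesIn E T - 1)
        - ((m + 2).choose 2 : ℝ) * #E / (#V).choose 2
          * ∑ T ∈ V.powersetCard (m + 2), t ^ edgesIn E T|
      ≤ ((m + 2).choose 2 : ℝ) * #E / (#V).choose 2 * ((#V).choose (m + 2) * δ) := by
  obtain ⟨ht0, ht1⟩ := ht
  set P := V.powersetCard 2 with hP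
  set C : ℝ := ((#V).choose 2 : ℝ) with hC
  have hCpos : 0 < C := by
    rw [hC]; exact_mod_cast Nat.choose_pos (by omega)
  have hPc : (#P : ℝ) = C := by rw [hP, card_powersetCard]
  set M : ℝ := ((#V - 2).choose m : ℝ) with hM
  set κ : ℝ := (m : ℝ) / ((#V : ℝ) - 2) with hκ
  set b : ℝ := ((m + 2).choose 2 : ℝ) with hb
  set K : ℝ := ((#V).choose (m + 2) : ℝ) with hK
  have hKb : K * b = C * M := by
    have := Nat.choose_mul (n := #V) (k := m + 2) (s := 2) (by omega)
    rw [Nat.add_sub_cancel] at this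
    rw [hK, hb, hC, hM]
    exact_mod_cast this
  have hVr : (3 : ℝ) ≤ #V := by exact_mod_cast hV
  have hκ0 : 0 ≤ κ := div_nonneg (by positivity) (by linarith)
  have hM0 : 0 ≤ M := by positivity
  set G : ℝ := ∑ T ∈ V.powersetCard (m + 2), t ^ edgesIn E T with hG
  -- The exponent is the number of edges in `p ∪ R`, not counting `p` itself in `Z p`; in `U p` it
  -- is the number of edges in `R` alone.
  set U : Finset α → ℝ := fun p => ∑ R ∈ (V \ p).powersetCard m, t ^ edgesIn E R with hU
  set Z : Finset α → ℝ := fun p =>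
    ∑ R ∈ (V \ p).powersetCard m, t ^ (edgesIn E (p ∪ R) - if p ∈ E then 1 else 0) with hZ
  set X : Finset α → ℝ := fun p =>
    ∑ R ∈ (V \ p).powersetCard m, t ^ edgesIn E (p ∪ R) with hX
  have hB : ∑ T ∈ V.powersetCard (m + 2), (edgesIn E T : ℝ) * t ^ (edgesIn E T - 1)
      = ∑ p ∈ E, Z p := by
    rw [sum_edgesIn_mul]
    refine Finset.sum_congr rfl fun p hp => ?_
    obtain ⟨hpV, hp2⟩ := mem_powersetCard.1 (hE hp)
    have := sum_powersetCard_superset V p hpV m fun T => t ^ (edgesIn E T - 1)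
    rw [hp2] at this
    rw [this, hZ]
    simp only [if_pos hp]
  have hA : b * G = ∑ q ∈ P, X q := by
    have h := sum_edgesIn_mul P (V.powersetCard (m + 2)) fun T => t ^ edgesIn E T
    rw [Finset.sum_congr rfl fun T hT => by rw [edgesIn_powersetCard_two hT],
      ← Finset.mul_sum] at h
    rw [hb, hG, h]
    refine Finset.sum_congr rfl fun p hp => ?_
    obtain ⟨hpV, hp2⟩ := mem_powersetCard.1 hp
    have := sum_powersetCard_superset V p hpV m fun T => t ^ edgesIn E T
    rw [hp2] at this
    exact this
  rw [hB]
  have hcard : ∀ p ∈ P, ∀ f : Finset α → ℕ,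
      ∑ R ∈ (V \ p).powersetCard m, t ^ f R ≤ M := by
    intro p hp f
    obtain ⟨hpV, hp2⟩ := mem_powersetCard.1 hp
    calc _ ≤ ∑ R ∈ (V \ p).powersetCard m, (1 : ℝ) :=
          Finset.sum_le_sum fun R _ => pow_le_one₀ ht0 ht1
      _ = M := by simp [card_sdiff_of_subset hpV, hp2, hM]
  have hZ0 : ∀ p, 0 ≤ Z p := fun p => Finset.sum_nonneg fun R _ => pow_nonneg ht0 _
  have hX0 : ∀ p, 0 ≤ X p := fun p => Finset.sum_nonneg fun R _ => pow_nonneg ht0 _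
  have hXZ : ∀ q, X q ≤ Z q := fun q => Finset.sum_le_sum fun R _ =>
    pow_le_pow_of_le_one ht0 ht1 (Nat.sub_le _ _)
  have hZX : ∀ q ∈ P, Z q ≤ X q + if q ∈ E then M else 0 := by
    intro q hq
    split_ifs with hqE
    · have := hcard q hq fun R => edgesIn E (q ∪ R) - if q ∈ E then 1 else 0
      have := hX0 q
      linarith
    · simp only [hZ, hX, if_neg hqE, Nat.sub_zero, add_zero, le_refl]
  have hcmp : ∀ p ∈ E, ∀ q ∈ P, Z p - X q ≤ κ * (2 + 2 * Δ) * M + (if q ∈ E then M else 0) ∧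
      X q - Z p ≤ κ * (2 + 2 * Δ) * M := by
    intro p hp q hq
    have hb1 := sum_pow_union_bounds (m := m) hV hE hΔ ht0 ht1 (hE hp)
    have hb2 := sum_pow_union_bounds (m := m) hV hE hΔ ht0 ht1 hq
    have hu1 := sum_pow_sdiff_le (E := E) (m := m) hV ht0 ht1 (hE hp) hq
    have hu2 := sum_pow_sdiff_le (E := E) (m := m) hV ht0 ht1 hq (hE hp)
    have h1 := hXZ q
    have h2 := hZX q hq
    constructor
    · linarith [hb1.1, hb2.2]
    · linarith [hb1.2, hb2.1]
  have hsum : C * ∑ p ∈ E, Z p - #E * (b * G) = ∑ p ∈ E, ∑ q ∈ P, (Z p - X q) := by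
    simp only [Finset.sum_sub_distrib, Finset.sum_const, nsmul_eq_mul, ← Finset.mul_sum, hA, hPc]
  have hfin : |C * ∑ p ∈ E, Z p - #E * (b * G)| ≤ C * #E * M * δ := by
    rcases hδ with hδ | hδ
    -- Average the comparison of `Z p` and `X q` over all `p ∈ E` and all pairs `q`.
    · have hup : ∑ p ∈ E, ∑ q ∈ P, (Z p - X q)
          ≤ ∑ p ∈ E, ∑ q ∈ P, (κ * (2 + 2 * Δ) * M + if q ∈ E then M else 0) :=
        Finset.sum_le_sum fun p hp => Finset.sum_le_sum fun q hq => (hcmp p hp q hq).1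
      have hlo : ∑ p ∈ E, ∑ q ∈ P, (-(κ * (2 + 2 * Δ) * M)) ≤ ∑ p ∈ E, ∑ q ∈ P, (Z p - X q) :=
        Finset.sum_le_sum fun p hp => Finset.sum_le_sum fun q hq => by
          linarith [(hcmp p hp q hq).2]
      have hEP : ∑ q ∈ P, (if q ∈ E then M else 0) = #E * M := by
        rw [← Finset.sum_filter, Finset.filter_mem_eq_inter, inter_eq_right.2 hE]
        simp
      simp only [Finset.sum_add_distrib, hEP, Finset.sum_const, nsmul_eq_mul, hPc] at hup hlo
      have hE0 : (0 : ℝ) ≤ #E := by positivity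
      have hδ' : C * #E * M * ((#E : ℝ) / C + κ * (2 + 2 * Δ)) ≤ C * #E * M * δ :=
        mul_le_mul_of_nonneg_left hδ (by positivity)
      have hexp : C * #E * M * ((#E : ℝ) / C + κ * (2 + 2 * Δ))
          = #E * (#E * M) + #E * (C * (κ * (2 + 2 * Δ) * M)) := by
        field_simp
      have hEM : 0 ≤ (#E : ℝ) * (#E * M) := by positivity
      rw [hsum, abs_le]
      constructor <;> linarith
    -- For `δ ≥ 1` both terms of the difference already lie between `0` and the bound.
    · have h1 : ∑ p ∈ E, Z p ≤ #E * M := by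
        calc _ ≤ ∑ p ∈ E, M := Finset.sum_le_sum fun p hp => hcard p (hE hp) _
          _ = _ := by simp
      have h2 : b * G ≤ C * M := by
        rw [hA, ← hPc]
        calc _ ≤ ∑ p ∈ P, M := Finset.sum_le_sum fun p hp => hcard p hp _
          _ = _ := by simp
      have h3 : 0 ≤ ∑ p ∈ E, Z p := Finset.sum_nonneg fun p _ => hZ0 p
      have h4 : 0 ≤ b * G := by
        rw [hA]; exact Finset.sum_nonneg fun p _ => hX0 p
      have hE0 : (0 : ℝ) ≤ #E := by positivity
      have h5 : C * #E * M * 1 ≤ C * #E * M * δ := mul_le_mul_of_nonneg_left hδ (by positivity)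
      have h6 := mul_le_mul_of_nonneg_left h1 hCpos.le
      have h7 := mul_le_mul_of_nonneg_left h2 hE0
      have h8 := mul_nonneg hCpos.le h3
      have h9 := mul_nonneg hE0 h4
      rw [abs_le]
      constructor <;> linarith
  have hdiv : ∑ p ∈ E, Z p - b * #E / C * G = (C * ∑ p ∈ E, Z p - #E * (b * G)) / C := by
    field_simp
  rw [hdiv, abs_div, abs_of_pos hCpos, div_le_iff₀ hCpos]
  refine hfin.trans (le_of_eq ?_)
  have : b * #E / C * (K * δ) * C = (K * b) * #E * δ := by field_simp
  rw [this, hKb]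
  ring

/-- Poisson approximation for independent sets: the number of `(m + 2)`-subsets of `V` that span
no edge is close to `e⁻ˡ` times the number of all `(m + 2)`-subsets, where `l` is the mean number
of edges inside a random `(m + 2)`-subset. -/
theorem abs_card_independent_sub_le (hV : 3 ≤ #V) (hE : E ⊆ V.powersetCard 2)
    (hΔ : ∀ a ∈ V, #{f ∈ E | a ∈ f} ≤ Δ) {l : ℝ}
    (hl : l = ((m + 2).choose 2 : ℝ) * #E / (#V).choose 2) {δ : ℝ}
    (hδ : (#E : ℝ) / (#V).choose 2 + (m : ℝ) / ((#V : ℝ) - 2) * (2 + 2 * Δ) ≤ δ ∨ 1 ≤ δ) :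
    |(#{T ∈ V.powersetCard (m + 2) | ∀ p ∈ E, ¬ p ⊆ T} : ℝ)
        - Real.exp (-l) * (#V).choose (m + 2)|
      ≤ (#V).choose (m + 2) * δ * (1 - Real.exp (-l)) := by
  have h := abs_sub_exp_neg_mul_le_of_deriv
    (G := fun t => ∑ T ∈ V.powersetCard (m + 2), t ^ edgesIn E T)
    (G' := fun t => ∑ T ∈ V.powersetCard (m + 2), (edgesIn E T : ℝ) * t ^ (edgesIn E T - 1))
    (l := l) (c := (#V).choose (m + 2) * δ)
    (fun t => HasDerivAt.fun_sum fun T _ => hasDerivAt_pow _ t)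
    (fun t ht => by rw [hl]; exact abs_deriv_sub_mul_le hV hE hΔ ht hδ)
  simp only [one_pow, Finset.sum_const, nsmul_eq_mul, mul_one, card_powersetCard] at h
  have h0 : (#{T ∈ V.powersetCard (m + 2) | ∀ p ∈ E, ¬ p ⊆ T} : ℝ)
      = ∑ T ∈ V.powersetCard (m + 2), (0 : ℝ) ^ edgesIn E T := by
    rw [Finset.card_filter, Nat.cast_sum]
    refine Finset.sum_congr rfl fun T _ => ?_
    -- Since `0 ^ 0 = 1`, setting `t = 0` counts the sets that span no edge.
    rw [zero_pow_eq, edgesIn]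
    simp [Finset.filter_eq_empty_iff]
  rw [h0]
  exact h

end Graph

/-! ### Rook placements on the staircase board -/

/-- The squares `(i, j)` with `i < j` in column `j` of the staircase board. -/
def boardCol (j : ℕ) : Finset (ℕ × ℕ) := range j ×ˢ {j}

/-- The squares `(i, j)` with `i < j < n` in row `i` of the staircase board. -/
def boardRow (n i : ℕ) : Finset (ℕ × ℕ) := {i} ×ˢ Ioo i n

/-- The staircase board: the squares `(i, j)` with `i < j < n`. -/
def board (n : ℕ) : Finset (ℕ × ℕ) := {x ∈ range n ×ˢ range n | x.1 < x.2}

theorem mem_board {n : ℕ} {x : ℕ × ℕ} : x ∈ board n ↔ x.1 < x.2 ∧ x.2 < n := by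
  simp only [board, mem_filter, mem_product, mem_range]
  omega

theorem mem_boardCol {j : ℕ} {x : ℕ × ℕ} : x ∈ boardCol j ↔ x.1 < j ∧ x.2 = j := by
  rw [boardCol, mem_product, mem_range, mem_singleton]

theorem mem_boardRow {n i : ℕ} {x : ℕ × ℕ} :
    x ∈ boardRow n i ↔ x.1 = i ∧ i < x.2 ∧ x.2 < n := by
  rw [boardRow, mem_product, mem_singleton, mem_Ioo]

theorem board_succ (n : ℕ) : board (n + 1) = board n ∪ boardCol n := by
  ext x
  simp only [mem_union, mem_board, mem_boardCol]
  omega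

theorem disjoint_board_boardCol (n : ℕ) : Disjoint (board n) (boardCol n) := by
  rw [disjoint_left]
  intro x
  simp only [mem_board, mem_boardCol]
  omega

theorem card_boardCol (j : ℕ) : #(boardCol j) = j := by simp [boardCol]

theorem card_boardRow (n i : ℕ) : #(boardRow n i) = n - 1 - i := by
  simp [boardRow]
  omega

theorem card_board (n : ℕ) : #(board n) = boardSize n := by
  induction n with
  | zero => simp [board, boardSize]
  | succ n ih =>
    rw [board_succ, card_union_of_disjoint (disjoint_board_boardCol n), ih, card_boardCol,
      boardSize, boardSize, Nat.choose_succ_succ' n 1, Nat.choose_one_right, Nat.add_comm]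

/-- The pairs of squares of the board that share a column. -/
def colPairs (n : ℕ) : Finset (Finset (ℕ × ℕ)) :=
  (range n).biUnion fun j => (boardCol j).powersetCard 2

/-- The pairs of squares of the board that share a row. -/
def rowPairs (n : ℕ) : Finset (Finset (ℕ × ℕ)) :=
  (range n).biUnion fun i => (boardRow n i).powersetCard 2

theorem pair_mem_colPairs {n : ℕ} {x y : ℕ × ℕ} (hx : x ∈ board n) (hy : y ∈ board n)
    (hxy : x ≠ y) (h : x.2 = y.2) : {x, y} ∈ colPairs n := by
  rw [mem_board] at hx hy
  simp only [colPairs, mem_biUnion, mem_range, mem_powersetCard]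
  refine ⟨x.2, hx.2, ?_, card_pair hxy⟩
  intro z hz
  simp only [mem_insert, mem_singleton] at hz
  rw [mem_boardCol]
  rcases hz with rfl | rfl
  · exact ⟨hx.1, rfl⟩
  · exact ⟨h ▸ hy.1, h.symm⟩

theorem pair_mem_rowPairs {n : ℕ} {x y : ℕ × ℕ} (hx : x ∈ board n) (hy : y ∈ board n)
    (hxy : x ≠ y) (h : x.1 = y.1) : {x, y} ∈ rowPairs n := by
  rw [mem_board] at hx hy
  simp only [rowPairs, mem_biUnion, mem_range, mem_powersetCard]
  refine ⟨x.1, by omega, ?_, card_pair hxy⟩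
  intro z hz
  simp only [mem_insert, mem_singleton] at hz
  rw [mem_boardRow]
  rcases hz with rfl | rfl
  · exact ⟨rfl, hx⟩
  · exact ⟨h.symm, h ▸ hy⟩

theorem mem_colPairs {n : ℕ} {p : Finset (ℕ × ℕ)} :
    p ∈ colPairs n ↔ p ∈ (board n).powersetCard 2 ∧ ∀ x ∈ p, ∀ y ∈ p, x.2 = y.2 := by
  constructor
  · intro h
    simp only [colPairs, mem_biUnion, mem_range, mem_powersetCard] at h
    obtain ⟨j, hj, hs, hc⟩ := h
    refine ⟨mem_powersetCard.2 ⟨fun x hx => ?_, hc⟩, fun x hx y hy => ?_⟩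
    · have := mem_boardCol.1 (hs hx)
      rw [mem_board]
      omega
    · rw [(mem_boardCol.1 (hs hx)).2, (mem_boardCol.1 (hs hy)).2]
  · rintro ⟨h, h2⟩
    obtain ⟨hs, hc⟩ := mem_powersetCard.1 h
    obtain ⟨x, y, hxy, rfl⟩ := card_eq_two.1 hc
    exact pair_mem_colPairs (hs (by simp)) (hs (by simp)) hxy (h2 x (by simp) y (by simp))

theorem mem_rowPairs {n : ℕ} {p : Finset (ℕ × ℕ)} :
    p ∈ rowPairs n ↔ p ∈ (board n).powersetCard 2 ∧ ∀ x ∈ p, ∀ y ∈ p, x.1 = y.1 := by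
  constructor
  · intro h
    simp only [rowPairs, mem_biUnion, mem_range, mem_powersetCard] at h
    obtain ⟨j, hj, hs, hc⟩ := h
    refine ⟨mem_powersetCard.2 ⟨fun x hx => ?_, hc⟩, fun x hx y hy => ?_⟩
    · have := mem_boardRow.1 (hs hx)
      rw [mem_board]
      omega
    · rw [(mem_boardRow.1 (hs hx)).1, (mem_boardRow.1 (hs hy)).1]
  · rintro ⟨h, h2⟩
    obtain ⟨hs, hc⟩ := mem_powersetCard.1 h
    obtain ⟨x, y, hxy, rfl⟩ := card_eq_two.1 hc
    exact pair_mem_rowPairs (hs (by simp)) (hs (by simp)) hxy (h2 x (by simp) y (by simp))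

theorem sum_range_choose_two (n : ℕ) : ∑ j ∈ range n, j.choose 2 = n.choose 3 := by
  induction n with
  | zero => simp
  | succ n ih => rw [sum_range_succ, ih, Nat.choose_succ_succ' n 2, Nat.add_comm]

theorem card_colPairs (n : ℕ) : #(colPairs n) = n.choose 3 := by
  rw [colPairs, card_biUnion, ← sum_range_choose_two]
  · simp [card_boardCol]
  · intro i _ j _ hij
    rw [Function.onFun, disjoint_left]
    intro p hp hp'
    obtain ⟨hs, hc⟩ := mem_powersetCard.1 hp
    obtain ⟨hs', _⟩ := mem_powersetCard.1 hp'
    obtain ⟨x, hx⟩ := card_pos.1 (show 0 < #p by omega)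
    exact hij ((mem_boardCol.1 (hs hx)).2.symm.trans (mem_boardCol.1 (hs' hx)).2)

theorem card_rowPairs (n : ℕ) : #(rowPairs n) = n.choose 3 := by
  rw [rowPairs, card_biUnion, ← sum_range_choose_two,
    ← sum_range_reflect fun j => j.choose 2]
  · simp [card_boardRow]
  · intro i _ j _ hij
    rw [Function.onFun, disjoint_left]
    intro p hp hp'
    obtain ⟨hs, hc⟩ := mem_powersetCard.1 hp
    obtain ⟨hs', _⟩ := mem_powersetCard.1 hp'
    obtain ⟨x, hx⟩ := card_pos.1 (show 0 < #p by omega)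
    exact hij ((mem_boardRow.1 (hs hx)).1.symm.trans (mem_boardRow.1 (hs' hx)).1)

theorem card_colPairs_union_rowPairs (n : ℕ) :
    #(colPairs n ∪ rowPairs n) = 2 * n.choose 3 := by
  rw [card_union_of_disjoint, card_colPairs, card_rowPairs, two_mul]
  rw [disjoint_left]
  intro p hp hp'
  obtain ⟨hp, h2⟩ := mem_colPairs.1 hp
  obtain ⟨_, h1⟩ := mem_rowPairs.1 hp'
  obtain ⟨x, y, hxy, rfl⟩ := card_eq_two.1 (mem_powersetCard.1 hp).2
  exact hxy (Prod.ext (h1 x (by simp) y (by simp)) (h2 x (by simp) y (by simp)))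

theorem card_le_of_forall_pair {α : Type*} [DecidableEq α] {F : Finset (Finset α)} {S : Finset α}
    {a : α} (haS : a ∈ S) (hF : ∀ f ∈ F, a ∈ f ∧ #f = 2 ∧ f ⊆ S) : #F ≤ #S - 1 := by
  rw [← card_erase_of_mem haS]
  have : F ⊆ (S.erase a).image fun b => {a, b} := by
    intro f hf
    obtain ⟨haf, hc, hs⟩ := hF f hf
    obtain ⟨x, y, hxy, rfl⟩ := card_eq_two.1 hc
    simp only [mem_insert, mem_singleton] at haf
    rw [mem_image]
    rcases haf with rfl | rfl
    · exact ⟨y, mem_erase.2 ⟨hxy.symm, hs (by simp)⟩, rfl⟩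
    · exact ⟨x, mem_erase.2 ⟨hxy, hs (by simp)⟩, pair_comm _ _⟩
  exact (card_le_card this).trans card_image_le

theorem card_colPairs_mem_le {n : ℕ} {a : ℕ × ℕ} (ha : a ∈ board n) :
    #{f ∈ colPairs n | a ∈ f} ≤ n - 2 := by
  rw [mem_board] at ha
  refine (card_le_of_forall_pair (S := boardCol a.2) (mem_boardCol.2 ⟨ha.1, rfl⟩) ?_).trans ?_
  · intro f hf
    obtain ⟨hf, haf⟩ := mem_filter.1 hf
    obtain ⟨hf, h⟩ := mem_colPairs.1 hf
    obtain ⟨hs, hc⟩ := mem_powersetCard.1 hf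
    refine ⟨haf, hc, fun x hx => ?_⟩
    have h1 := h x hx a haf
    have h2 := mem_board.1 (hs hx)
    exact mem_boardCol.2 ⟨by omega, h1⟩
  · rw [card_boardCol]; omega

theorem card_rowPairs_mem_le {n : ℕ} {a : ℕ × ℕ} (ha : a ∈ board n) :
    #{f ∈ rowPairs n | a ∈ f} ≤ n - 2 := by
  rw [mem_board] at ha
  refine (card_le_of_forall_pair (S := boardRow n a.1) (mem_boardRow.2 ⟨rfl, ha⟩) ?_).trans ?_
  · intro f hf
    obtain ⟨hf, haf⟩ := mem_filter.1 hf
    obtain ⟨hf, h⟩ := mem_rowPairs.1 hf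
    obtain ⟨hs, hc⟩ := mem_powersetCard.1 hf
    refine ⟨haf, hc, fun x hx => ?_⟩
    have h1 := h x hx a haf
    have h2 := mem_board.1 (hs hx)
    exact mem_boardRow.2 ⟨h1, by omega, h2.2⟩
  · rw [card_boardRow]; omega

theorem card_colPairs_union_rowPairs_mem_le {n : ℕ} {a : ℕ × ℕ} (ha : a ∈ board n) :
    #{f ∈ colPairs n ∪ rowPairs n | a ∈ f} ≤ 2 * (n - 2) := by
  rw [filter_union]
  have := card_colPairs_mem_le ha
  have := card_rowPairs_mem_le ha
  exact (card_union_le _ _).trans (by omega)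

theorem forall_colPairs_not_subset {n : ℕ} {T : Finset (ℕ × ℕ)} (hT : T ⊆ board n) :
    (∀ p ∈ colPairs n, ¬ p ⊆ T) ↔ Set.InjOn Prod.snd (T : Set (ℕ × ℕ)) := by
  constructor
  · intro h x hx y hy hxy
    by_contra hne
    refine h _ (pair_mem_colPairs (hT hx) (hT hy) hne hxy) ?_
    intro z hz
    simp only [mem_insert, mem_singleton] at hz
    rcases hz with rfl | rfl <;> assumption
  · intro h p hp hpT
    obtain ⟨hp, h2⟩ := mem_colPairs.1 hp
    obtain ⟨x, y, hxy, rfl⟩ := card_eq_two.1 (mem_powersetCard.1 hp).2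
    exact hxy (h (hpT (by simp)) (hpT (by simp)) (h2 x (by simp) y (by simp)))

theorem forall_rowPairs_not_subset {n : ℕ} {T : Finset (ℕ × ℕ)} (hT : T ⊆ board n) :
    (∀ p ∈ rowPairs n, ¬ p ⊆ T) ↔ Set.InjOn Prod.fst (T : Set (ℕ × ℕ)) := by
  constructor
  · intro h x hx y hy hxy
    by_contra hne
    refine h _ (pair_mem_rowPairs (hT hx) (hT hy) hne hxy) ?_
    intro z hz
    simp only [mem_insert, mem_singleton] at hz
    rcases hz with rfl | rfl <;> assumption
  · intro h p hp hpT
    obtain ⟨hp, h2⟩ := mem_rowPairs.1 hp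
    obtain ⟨x, y, hxy, rfl⟩ := card_eq_two.1 (mem_powersetCard.1 hp).2
    exact hxy (h (hpT (by simp)) (hpT (by simp)) (h2 x (by simp) y (by simp)))

open Classical in
/-- The placements of `k` rooks on the board of size `n` that satisfy `P`. -/
noncomputable def placements (P : Finset (ℕ × ℕ) → Prop) (n k : ℕ) : Finset (Finset (ℕ × ℕ)) :=
  {T ∈ (board n).powersetCard k | P T}

theorem mem_placements {P : Finset (ℕ × ℕ) → Prop} {n k : ℕ} {T : Finset (ℕ × ℕ)} :
    T ∈ placements P n k ↔ (T ⊆ board n ∧ #T = k) ∧ P T := by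
  simp [placements, mem_powersetCard]

/-- Removing the last column: a placement of `k + 1` rooks on the board of size `n + 1` has no rook
in column `n`, or one rook there, on a square `(i, n)` with `i` in a set `A T` of size `s` depending
on the other rooks `T`. -/
theorem card_placements_succ_succ (P : Finset (ℕ × ℕ) → Prop) (A : Finset (ℕ × ℕ) → Finset ℕ)
    (n k s : ℕ) (hcol : ∀ T, P T → Set.InjOn Prod.snd (T : Set (ℕ × ℕ)))
    (hA : ∀ T ⊆ board n, ∀ i < n, P (insert (i, n) T) ↔ P T ∧ i ∈ A T)
    (hAn : ∀ T, A T ⊆ range n) (hs : ∀ T ∈ placements P n k, #(A T) = s) :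
    #(placements P (n + 1) (k + 1))
      = #(placements P n (k + 1)) + s * #(placements P n k) := by
  have hnot : ∀ T ⊆ board n, ∀ i, (i, n) ∉ T := by
    intro T hT i hi
    have := mem_board.1 (hT hi)
    simp at this
  have heq : placements P (n + 1) (k + 1) = placements P n (k + 1)
      ∪ (placements P n k).biUnion fun T => (A T).image fun i => insert (i, n) T := by
    ext T
    simp only [mem_union, mem_biUnion, mem_image, mem_placements]
    constructor
    · rintro ⟨⟨hT, hc⟩, hP⟩
      by_cases h : T ⊆ board n
      · exact Or.inl ⟨⟨h, hc⟩, hP⟩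
      right
      obtain ⟨⟨i, j⟩, hx, hxb⟩ := not_subset.1 h
      have hx' := hT hx
      rw [board_succ, mem_union, mem_boardCol] at hx'
      obtain ⟨hi, hj⟩ := hx'.resolve_left hxb
      simp only at hi hj
      subst hj
      have hTe : T.erase (i, j) ⊆ board j := by
        intro y hy
        obtain ⟨hne, hy⟩ := mem_erase.1 hy
        have hy' := hT hy
        rw [board_succ, mem_union, mem_boardCol] at hy'
        refine hy'.resolve_right fun h => hne (hcol T hP hy hx h.2)
      have hins := insert_erase hx
      have := (hA _ hTe i hi).1 (hins.symm ▸ hP)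
      exact ⟨T.erase (i, j), ⟨⟨hTe, by rw [card_erase_of_mem hx, hc]; rfl⟩, this.1⟩, i, this.2,
        hins⟩
    · rintro (⟨⟨hT, hc⟩, hP⟩ | ⟨T', ⟨⟨hT, hc⟩, hP⟩, i, hi, rfl⟩)
      · refine ⟨⟨hT.trans ?_, hc⟩, hP⟩
        rw [board_succ]
        exact subset_union_left
      · have hin : i < n := mem_range.1 (hAn _ hi)
        refine ⟨⟨insert_subset ?_ (hT.trans ?_), ?_⟩, (hA _ hT i hin).2 ⟨hP, hi⟩⟩
        · simp [mem_board, hin]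
        · rw [board_succ]
          exact subset_union_left
        · rw [card_insert_of_notMem (hnot _ hT i), hc]
  have hdis : Disjoint (placements P n (k + 1))
      ((placements P n k).biUnion fun T => (A T).image fun i => insert (i, n) T) := by
    rw [disjoint_left]
    intro T hT hT'
    simp only [mem_biUnion, mem_image, mem_placements] at hT hT'
    obtain ⟨T', _, i, _, rfl⟩ := hT'
    exact hnot _ hT.1.1 i (mem_insert_self _ _)
  have hinj : ∀ T ⊆ board n, ∀ T' ⊆ board n, ∀ i i' : ℕ,
      (insert (i, n) T : Finset (ℕ × ℕ)) = insert (i', n) T' → T = T' ∧ i = i' := by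
    intro T hT T' hT' i i' h
    have h1 : (i, n) ∈ insert (i', n) T' := h ▸ mem_insert_self _ _
    have h2 : i = i' := by
      rcases mem_insert.1 h1 with h1 | h1
      · simpa using h1
      · exact absurd h1 (hnot _ hT' i)
    subst h2
    exact ⟨by rw [← erase_insert (hnot _ hT i), h, erase_insert (hnot _ hT' i)], rfl⟩
  rw [heq, card_union_of_disjoint hdis, card_biUnion]
  · rw [Finset.sum_congr rfl (g := fun _ => s), Finset.sum_const, smul_eq_mul, Nat.mul_comm]
    intro T hT
    rw [card_image_of_injOn, hs T hT]
    intro i _ i' _ h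
    have hb := (mem_placements.1 hT).1.1
    exact (hinj T hb T hb i i' h).2
  · intro T hT T' hT' hne
    rw [Function.onFun, disjoint_left]
    intro S hS hS'
    simp only [mem_image] at hS hS'
    obtain ⟨i, _, rfl⟩ := hS
    obtain ⟨i', _, h⟩ := hS'
    exact hne (hinj T' (mem_placements.1 hT').1.1 T (mem_placements.1 hT).1.1 i' i h).1.symm

theorem card_placements_of_lt (P : Finset (ℕ × ℕ) → Prop) {n k : ℕ} (hk : n < k)
    (hcol : ∀ T, P T → Set.InjOn Prod.snd (T : Set (ℕ × ℕ))) : #(placements P n k) = 0 := by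
  rw [card_eq_zero, eq_empty_iff_forall_notMem]
  intro T hT
  obtain ⟨⟨hT, hc⟩, hP⟩ := mem_placements.1 hT
  have := card_le_card_of_injOn (t := range n) Prod.snd
    (fun x hx => by
      have := mem_board.1 (hT hx)
      simpa using this.2) (hcol T hP)
  rw [card_range] at this
  omega

theorem card_placements_zero (P : Finset (ℕ × ℕ) → Prop) (n : ℕ) (hP : P ∅) :
    #(placements P n 0) = 1 := by
  rw [card_eq_one]
  refine ⟨∅, ?_⟩
  ext T
  simp only [mem_placements, card_eq_zero, mem_singleton]
  constructor
  · exact fun h => h.1.2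
  · rintro rfl
    simp [hP]

theorem injOn_insert_snd {n i : ℕ} {T : Finset (ℕ × ℕ)} (hT : T ⊆ board n) :
    Set.InjOn Prod.snd ((insert (i, n) T : Finset (ℕ × ℕ)) : Set (ℕ × ℕ))
      ↔ Set.InjOn Prod.snd (T : Set (ℕ × ℕ)) := by
  rw [coe_insert, Set.injOn_insert]
  · refine and_iff_left ?_
    rintro ⟨x, hx, h⟩
    have := mem_board.1 (hT hx)
    simp only at h
    omega
  · intro h
    have := mem_board.1 (hT h)
    simp at this

theorem injOn_insert_fst {n i : ℕ} {T : Finset (ℕ × ℕ)} (hT : T ⊆ board n) :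
    Set.InjOn Prod.fst ((insert (i, n) T : Finset (ℕ × ℕ)) : Set (ℕ × ℕ))
      ↔ Set.InjOn Prod.fst (T : Set (ℕ × ℕ)) ∧ i ∉ T.image Prod.fst := by
  rw [coe_insert, Set.injOn_insert]
  · rw [← coe_image, mem_coe]
  · intro h
    have := mem_board.1 (hT h)
    simp at this

/-- Stirling numbers of the first kind count placements with at most one rook in each column. -/
theorem card_placements_stirlingFirst (n k : ℕ) (hk : k ≤ n) :
    #(placements (fun T => Set.InjOn Prod.snd (T : Set (ℕ × ℕ))) n k)
      = Nat.stirlingFirst n (n - k) := by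
  induction n generalizing k with
  | zero =>
    obtain rfl : k = 0 := by omega
    rw [card_placements_zero _ _ (by simp)]
    rfl
  | succ n ih =>
    rcases k with _ | k
    · rw [card_placements_zero _ _ (by simp), Nat.sub_zero, Nat.stirlingFirst_self]
    rw [card_placements_succ_succ _ (fun _ => range n) n k n (fun T h => h)
      (fun T hT i hi => by simp only [injOn_insert_snd hT, mem_range, hi, and_true])
      (fun _ => le_rfl) (fun _ _ => card_range n), ih k (by omega), Nat.add_sub_add_right]
    rcases Nat.lt_or_ge k n with h | h
    · rw [ih (k + 1) h]
      obtain ⟨r, hr⟩ : ∃ r, n - k = r + 1 := ⟨n - k - 1, by omega⟩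
      rw [hr, show n - (k + 1) = r by omega, Nat.stirlingFirst_succ_succ]
      ring
    · obtain rfl : k = n := by omega
      rw [card_placements_of_lt _ (by omega) (fun T h => h), Nat.sub_self,
        Nat.stirlingFirst_succ_zero]
      rcases k with _ | k <;> simp

/-- Stirling numbers of the second kind count placements of non-attacking rooks. -/
theorem card_placements_stirlingSecond (n k : ℕ) (hk : k ≤ n) :
    #(placements (fun T => Set.InjOn Prod.snd (T : Set (ℕ × ℕ))
        ∧ Set.InjOn Prod.fst (T : Set (ℕ × ℕ))) n k)
      = Nat.stirlingSecond n (n - k) := by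
  induction n generalizing k with
  | zero =>
    obtain rfl : k = 0 := by omega
    rw [card_placements_zero _ _ (by simp)]
    rfl
  | succ n ih =>
    rcases k with _ | k
    · rw [card_placements_zero _ _ (by simp), Nat.sub_zero, Nat.stirlingSecond_self]
    rw [card_placements_succ_succ _ (fun T => range n \ T.image Prod.fst) n k (n - k)
      (fun T h => h.1)
      (fun T hT i hi => by
        simp only [injOn_insert_snd hT, injOn_insert_fst hT, Finset.mem_sdiff, mem_range, hi,
          true_and, and_assoc])
      (fun _ => sdiff_subset) ?_, ih k (by omega), Nat.add_sub_add_right]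
    · rcases Nat.lt_or_ge k n with h | h
      · rw [ih (k + 1) h]
        obtain ⟨r, hr⟩ : ∃ r, n - k = r + 1 := ⟨n - k - 1, by omega⟩
        rw [hr, show n - (k + 1) = r by omega, Nat.stirlingSecond_succ_succ]
        ring
      · obtain rfl : k = n := by omega
        rw [card_placements_of_lt _ (by omega) (fun T h => h.1), Nat.sub_self,
          Nat.stirlingSecond_succ_zero]
        simp
    · intro T hT
      obtain ⟨⟨hT, hc⟩, _, hP⟩ := mem_placements.1 hT
      rw [card_sdiff_of_subset, card_image_of_injOn hP, card_range, hc]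
      intro i hi
      obtain ⟨x, hx, rfl⟩ := mem_image.1 hi
      have := mem_board.1 (hT hx)
      rw [mem_range]
      omega

/-! ### Estimates for the error terms -/

theorem cast_choose_three (n : ℕ) : (n.choose 3 : ℝ) = n * (n - 1) * (n - 2) / 6 := by
  induction n with
  | zero => simp
  | succ n ih =>
    rw [Nat.choose_succ_succ' n 2, Nat.cast_add, ih, Nat.cast_choose_two]
    push_cast
    ring

theorem cast_choose_four (n : ℕ) : (n.choose 4 : ℝ) = n * (n - 1) * (n - 2) * (n - 3) / 24 := by
  induction n with
  | zero => simp
  | succ n ih =>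
    rw [Nat.choose_succ_succ' n 3, Nat.cast_add, ih, cast_choose_three]
    push_cast
    ring

theorem cast_boardSize (n : ℕ) : (boardSize n : ℝ) = n * (n - 1) / 2 :=
  Nat.cast_choose_two ℝ n

theorem cast_boardSize_choose_two (n : ℕ) :
    ((boardSize n).choose 2 : ℝ) = (n - 2) * (n - 1) * n * (n + 1) / 8 := by
  rw [Nat.cast_choose_two, cast_boardSize]
  ring

variable {n k : ℕ}

/-- The probability that two random squares of the board share a column. -/
theorem choose_three_div_boardSize (hn : 3 ≤ n) :
    (n.choose 3 : ℝ) / ((boardSize n).choose 2 : ℝ) = 4 / (3 * ((n : ℝ) + 1)) := by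
  have hr : (3 : ℝ) ≤ n := by exact_mod_cast hn
  have h1 : (n : ℝ) - 1 ≠ 0 := by linarith
  have h2 : (n : ℝ) - 2 ≠ 0 := by linarith
  have h3 : (n : ℝ) + 1 ≠ 0 := by linarith
  have h4 : (n : ℝ) ≠ 0 := by linarith
  rw [cast_choose_three, cast_boardSize_choose_two]
  field_simp
  norm_num

theorem choose_four_div_choose_three (hn : 3 ≤ n) (a b : ℝ) :
    6 * (n.choose 4 : ℝ) * a / ((n.choose 3 : ℝ) * b) = 3 / 2 * ((n : ℝ) - 3) * (a / b) := by
  have hr : (3 : ℝ) ≤ n := by exact_mod_cast hn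
  have h1 : (n : ℝ) - 1 ≠ 0 := by linarith
  have h2 : (n : ℝ) - 2 ≠ 0 := by linarith
  have h4 : (n : ℝ) ≠ 0 := by linarith
  rw [cast_choose_three, cast_choose_four]
  rcases eq_or_ne b 0 with rfl | hb
  · simp
  field_simp
  ring

theorem boardSize_sub_two_pos (hn : 3 ≤ n) : 0 < (n : ℝ) * (n - 1) - 4 := by
  have hr : (3 : ℝ) ≤ n := by exact_mod_cast hn
  nlinarith

theorem div_boardSize_sub_two (a : ℝ) :
    a / ((boardSize n : ℝ) - 2) = 2 * a / ((n : ℝ) * (n - 1) - 4) := by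
  rw [cast_boardSize, show (n : ℝ) * (n - 1) / 2 - 2 = ((n : ℝ) * (n - 1) - 4) / 2 by ring,
    div_div_eq_mul_div, mul_comm a 2]

theorem tau_eq : tau n k
    = 8 * (3 * ((k : ℝ) - 2) ^ 2 + 1) / (((n : ℝ) - 2) * (n - 1) * n * (n + 1)) := by
  rw [tau, cast_boardSize_choose_two, div_div_eq_mul_div]
  ring

theorem d₁_eq (hn : 3 ≤ n) : d₁ n k = 4 / (3 * ((n : ℝ) + 1)) + tau n k
    + (1 - tau n k) * (((k : ℝ) - 2)
      * (16 / (3 * ((n : ℝ) + 1)) + 3 * ((n : ℝ) - 3) / ((n : ℝ) * (n - 1) - 4))) := by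
  rw [d₁, choose_four_div_choose_three hn, mul_div_assoc (4 * ((k : ℝ) - 2)),
    choose_three_div_boardSize hn, div_boardSize_sub_two]
  ring

theorem d₂_eq (hn : 3 ≤ n) : d₂ n k = 8 / (3 * ((n : ℝ) + 1)) + tau n k
    + (1 - tau n k) * (((k : ℝ) - 2)
      * (32 / (3 * ((n : ℝ) + 1)) + (11 * (n : ℝ) - 29) / 2 / ((n : ℝ) * (n - 1) - 4))) := by
  rw [d₂, choose_four_div_choose_three hn, mul_div_assoc (8 * ((k : ℝ) - 2)), mul_div_assoc 2,
    choose_three_div_boardSize hn, div_boardSize_sub_two]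
  ring

theorem tau_nonneg (hn : 3 ≤ n) : 0 ≤ tau n k := by
  have hr : (3 : ℝ) ≤ n := by exact_mod_cast hn
  have h1 : 0 < (n : ℝ) - 1 := by linarith
  have h2 : 0 < (n : ℝ) - 2 := by linarith
  rw [tau_eq]
  positivity

/-- The factor `1 - τ`, negative for `n = k = 3`, is bounded away from `0` once `8 ≤ n`. -/
theorem tau_le (hn : 8 ≤ n) (hk2 : 2 ≤ k) (hk : k ≤ n) : tau n k ≤ 3 / 10 := by
  obtain ⟨s, rfl⟩ := Nat.exists_eq_add_of_le hn
  have hk2r : (2 : ℝ) ≤ k := by exact_mod_cast hk2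
  have hkr : (k : ℝ) ≤ 8 + s := by exact_mod_cast hk
  have hs : (0 : ℝ) ≤ s := by positivity
  rw [tau_eq]
  push_cast
  have hpos : 0 < ((8 : ℝ) + s - 2) * (8 + s - 1) * (8 + s) * (8 + s + 1) := by
    have h1 : 0 < (8 : ℝ) + s - 1 := by linarith
    have h2 : 0 < (8 : ℝ) + s - 2 := by linarith
    positivity
  rw [div_le_iff₀ hpos]
  have h1 : ((k : ℝ) - 2) ^ 2 ≤ (6 + s) ^ 2 := by
    apply pow_le_pow_left₀ <;> linarith
  have h3 : (0 : ℝ) ≤ s ^ 3 := by positivity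
  have h4 : (0 : ℝ) ≤ s ^ 4 := by positivity
  have h2 : (0 : ℝ) ≤ s ^ 2 := by positivity
  nlinarith

/-- `d₁` dominates the error of the Poisson approximation for the graph of pairs of squares in a
common column, whose degrees are at most `n - 2`, unless `d₁` is at least the trivial bound `1`. -/
theorem error_le_d₁_or (hn : 3 ≤ n) (hk2 : 2 ≤ k) (hk : k ≤ n) :
    4 / (3 * ((n : ℝ) + 1)) + ((k : ℝ) - 2) * (4 * ((n : ℝ) - 1) / ((n : ℝ) * (n - 1) - 4))
        ≤ d₁ n k ∨ 1 ≤ d₁ n k := by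
  rw [d₁_eq hn]
  rcases Nat.lt_or_ge n 8 with h8 | h8
  · rw [tau_eq]
    interval_cases n <;> interval_cases k <;> first | (left; norm_num; done) | (right; norm_num)
  left
  have ht := tau_le h8 hk2 hk
  have ht0 := tau_nonneg (n := n) (k := k) hn
  have hr : (8 : ℝ) ≤ n := by exact_mod_cast h8
  have hk2r : (0 : ℝ) ≤ (k : ℝ) - 2 := by
    have : (2 : ℝ) ≤ k := by exact_mod_cast hk2
    linarith
  have hpos := boardSize_sub_two_pos hn
  set B := 16 / (3 * ((n : ℝ) + 1)) + 3 * ((n : ℝ) - 3) / ((n : ℝ) * (n - 1) - 4) with hB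
  have hB0 : 0 ≤ B := by
    have : 0 ≤ (n : ℝ) - 3 := by linarith
    positivity
  have hAB : 4 * ((n : ℝ) - 1) / ((n : ℝ) * (n - 1) - 4) ≤ 7 / 10 * B := by
    rw [hB, div_add_div _ _ (by positivity) hpos.ne', ← mul_div_assoc,
      div_le_div_iff₀ hpos (by positivity)]
    have hq : 4 * ((n : ℝ) - 1) * (3 * ((n : ℝ) + 1)) ≤ 7 / 10 * (16 * ((n : ℝ) * (n - 1) - 4)
        + 3 * ((n : ℝ) + 1) * (3 * ((n : ℝ) - 3))) := by nlinarith
    have := mul_le_mul_of_nonneg_right hq hpos.le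
    linarith
  have h1 := mul_le_mul_of_nonneg_left hAB hk2r
  have h2 : 7 / 10 * (((k : ℝ) - 2) * B) ≤ (1 - tau n k) * (((k : ℝ) - 2) * B) :=
    mul_le_mul_of_nonneg_right (by linarith) (by positivity)
  linarith

/-- `d₂` dominates the error of the Poisson approximation for the graph of attacking pairs of
squares, whose degrees are at most `2 (n - 2)`, unless `d₂` is at least the trivial bound `1`. -/
theorem error_le_d₂_or (hn : 3 ≤ n) (hk2 : 2 ≤ k) (hk : k ≤ n) (h33 : ¬ (n = 3 ∧ k = 3)) :
    8 / (3 * ((n : ℝ) + 1)) + ((k : ℝ) - 2) * ((8 * (n : ℝ) - 12) / ((n : ℝ) * (n - 1) - 4))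
        ≤ d₂ n k ∨ 1 ≤ d₂ n k := by
  rw [d₂_eq hn]
  rcases Nat.lt_or_ge n 8 with h8 | h8
  · rw [tau_eq]
    interval_cases n <;> interval_cases k <;>
      first | (left; norm_num; done) | (right; norm_num; done) | (norm_num at h33)
  left
  have ht := tau_le h8 hk2 hk
  have ht0 := tau_nonneg (n := n) (k := k) hn
  have hr : (8 : ℝ) ≤ n := by exact_mod_cast h8
  have hk2r : (0 : ℝ) ≤ (k : ℝ) - 2 := by
    have : (2 : ℝ) ≤ k := by exact_mod_cast hk2
    linarith
  have hpos := boardSize_sub_two_pos hn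
  set B := 32 / (3 * ((n : ℝ) + 1)) + (11 * (n : ℝ) - 29) / 2 / ((n : ℝ) * (n - 1) - 4) with hB
  have hB0 : 0 ≤ B := by
    have : 0 ≤ 11 * (n : ℝ) - 29 := by linarith
    positivity
  have hAB : (8 * (n : ℝ) - 12) / ((n : ℝ) * (n - 1) - 4) ≤ 7 / 10 * B := by
    rw [hB, div_add_div _ _ (by positivity) hpos.ne', ← mul_div_assoc,
      div_le_div_iff₀ hpos (by positivity)]
    have hq : (8 * (n : ℝ) - 12) * (3 * ((n : ℝ) + 1)) ≤ 7 / 10 * (32 * ((n : ℝ) * (n - 1) - 4)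
        + 3 * ((n : ℝ) + 1) * ((11 * (n : ℝ) - 29) / 2)) := by nlinarith
    have := mul_le_mul_of_nonneg_right hq hpos.le
    linarith
  have h1 := mul_le_mul_of_nonneg_left hAB hk2r
  have h2 : 7 / 10 * (((k : ℝ) - 2) * B) ≤ (1 - tau n k) * (((k : ℝ) - 2) * B) :=
    mul_le_mul_of_nonneg_right (by linarith) (by positivity)
  linarith

/-- Every term of `d₁` and `d₂` is `O(k / n)`; both have the shape bounded here, for suitable `a`,
`b`, `c`. -/
theorem error_le_div (hn : 8 ≤ n) (hk2 : 2 ≤ k) (hk : k ≤ n) {c a b : ℝ} (hc : c ≤ 8)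
    (ha0 : 0 ≤ a) (ha : a ≤ 32) (hb0 : 0 ≤ b) (hb : b ≤ 11 / 2 * n) :
    c / (3 * ((n : ℝ) + 1)) + tau n k
      + (1 - tau n k) * (((k : ℝ) - 2) * (a / (3 * ((n : ℝ) + 1)) + b / ((n : ℝ) * (n - 1) - 4)))
      ≤ 30 * (k / n) := by
  have hr : (8 : ℝ) ≤ n := by exact_mod_cast hn
  have hn0 : (0 : ℝ) < n := by linarith
  have hk2r : (2 : ℝ) ≤ k := by exact_mod_cast hk2
  have hkr : (k : ℝ) ≤ n := by exact_mod_cast hk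
  have hpos := boardSize_sub_two_pos (n := n) (by omega)
  have h1 : c / (3 * ((n : ℝ) + 1)) ≤ 3 * (k / n) := by
    rw [← mul_div_assoc, div_le_div_iff₀ (by positivity) hn0]
    nlinarith
  have h2 : tau n k ≤ k / n := by
    rw [tau_eq]
    have h42 : (42 : ℝ) ≤ ((n : ℝ) - 2) * (n - 1) := by nlinarith
    have hP : 42 * (n : ℝ) ^ 2 ≤ ((n : ℝ) - 2) * (n - 1) * n * (n + 1) := by
      have := mul_le_mul_of_nonneg_right h42 (by positivity : (0 : ℝ) ≤ n * (n + 1))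
      nlinarith
    have hQ : 8 * (3 * ((k : ℝ) - 2) ^ 2 + 1) ≤ 24 * (k * n) := by nlinarith
    have hkn : 0 ≤ (k : ℝ) * n := by positivity
    rw [div_le_div_iff₀ (by nlinarith) hn0]
    calc 8 * (3 * ((k : ℝ) - 2) ^ 2 + 1) * n ≤ 24 * (k * n) * n :=
          mul_le_mul_of_nonneg_right hQ hn0.le
      _ ≤ k * (42 * (n : ℝ) ^ 2) := by nlinarith
      _ ≤ _ := mul_le_mul_of_nonneg_left hP (by linarith)
  have h3 : a / (3 * ((n : ℝ) + 1)) + b / ((n : ℝ) * (n - 1) - 4) ≤ 26 / n := by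
    have h4 : a / (3 * ((n : ℝ) + 1)) ≤ 15 / n := by
      rw [div_le_div_iff₀ (by positivity) hn0]
      nlinarith
    have h5 : b / ((n : ℝ) * (n - 1) - 4) ≤ 11 / n := by
      rw [div_le_div_iff₀ hpos hn0]
      nlinarith
    calc _ ≤ 15 / (n : ℝ) + 11 / n := add_le_add h4 h5
      _ = _ := by ring
  have ht0 := tau_nonneg (n := n) (k := k) (by omega)
  have hS : 0 ≤ a / (3 * ((n : ℝ) + 1)) + b / ((n : ℝ) * (n - 1) - 4) := by positivity
  have h6 : ((k : ℝ) - 2) * (a / (3 * ((n : ℝ) + 1)) + b / ((n : ℝ) * (n - 1) - 4))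
      ≤ 26 * (k / n) := by
    calc _ ≤ (k : ℝ) * (26 / n) :=
          mul_le_mul (by linarith) h3 hS (by linarith)
      _ = _ := by ring
  have h7 : 0 ≤ ((k : ℝ) - 2) * (a / (3 * ((n : ℝ) + 1)) + b / ((n : ℝ) * (n - 1) - 4)) :=
    mul_nonneg (by linarith) hS
  nlinarith

theorem d₁_le_div (hn : 8 ≤ n) (hk2 : 2 ≤ k) (hk : k ≤ n) : d₁ n k ≤ 30 * (k / n) := by
  have hr : (8 : ℝ) ≤ n := by exact_mod_cast hn
  rw [d₁_eq (by omega)]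
  exact error_le_div hn hk2 hk (by norm_num) (by norm_num) (by norm_num) (by linarith)
    (by linarith)

theorem d₂_le_div (hn : 8 ≤ n) (hk2 : 2 ≤ k) (hk : k ≤ n) : d₂ n k ≤ 30 * (k / n) := by
  have hr : (8 : ℝ) ≤ n := by exact_mod_cast hn
  rw [d₂_eq (by omega)]
  exact error_le_div hn hk2 hk (by norm_num) (by norm_num) (by norm_num) (by linarith)
    (by linarith)

theorem mu_nonneg (n k : ℕ) : 0 ≤ mu n k := by
  rw [mu]
  positivity

theorem mu_le_sq_div (hn : 3 ≤ n) : mu n k ≤ (k : ℝ) ^ 2 / n := by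
  have hr : (3 : ℝ) ≤ n := by exact_mod_cast hn
  rw [mu, mul_div_assoc, choose_three_div_boardSize hn, Nat.cast_choose_two, ← mul_div_assoc,
    div_le_div_iff₀ (by positivity) (by linarith)]
  have hk : (0 : ℝ) ≤ k := by positivity
  have h1 : (0 : ℝ) ≤ k * n := by positivity
  have h2 : (0 : ℝ) ≤ (k : ℝ) ^ 2 * n := by positivity
  nlinarith [sq_nonneg (k : ℝ)]

/-! ### The bounds for Stirling numbers -/

/-- The factor `1 - e⁻ˡ` of the Poisson approximation turns the two bounds `d` and `1` into the
minimum of `d`, `l d` and `1`. -/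
theorem abs_sub_le_mul_min {C S l x d : ℝ} (hC : 0 ≤ C) (hl : 0 ≤ l) (hx : 0 ≤ x)
    (hd : x ≤ d ∨ 1 ≤ d)
    (h : ∀ δ, x ≤ δ ∨ 1 ≤ δ → |S - Real.exp (-l) * C| ≤ C * δ * (1 - Real.exp (-l))) :
    |S - Real.exp (-l) * C| ≤ C * min d (min (l * d) 1) := by
  have hd0 : 0 ≤ d := by rcases hd with hd | hd <;> linarith
  have h1 : x ≤ min d 1 ∨ 1 ≤ min d 1 := by
    rcases le_total 1 d with h1 | h1
    · exact Or.inr (le_min h1 le_rfl)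
    · rw [min_eq_left h1]
      exact hd
  refine (h _ h1).trans ?_
  rw [mul_assoc]
  refine mul_le_mul_of_nonneg_left ?_ hC
  have he0 : 0 ≤ 1 - Real.exp (-l) := by
    have : Real.exp (-l) ≤ 1 := Real.exp_le_one_iff.2 (by linarith)
    linarith
  have he1 : 1 - Real.exp (-l) ≤ 1 := by linarith [Real.exp_pos (-l)]
  have hel : 1 - Real.exp (-l) ≤ l := by linarith [Real.add_one_le_exp (-l)]
  have hm0 : 0 ≤ min d 1 := le_min hd0 zero_le_one
  refine le_min ?_ (le_min ?_ ?_)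
  · calc _ ≤ d * 1 := mul_le_mul (min_le_left _ _) he1 he0 hd0
      _ = d := mul_one d
  · calc _ ≤ d * l := mul_le_mul (min_le_left _ _) hel he0 hd0
      _ = l * d := mul_comm _ _
  · calc _ ≤ (1 : ℝ) * 1 := mul_le_mul (min_le_right _ _) he1 he0 zero_le_one
      _ = 1 := mul_one 1

theorem three_le_boardSize (hn : 3 ≤ n) : 3 ≤ boardSize n :=
  (Nat.choose_le_choose 2 hn : Nat.choose 3 2 ≤ n.choose 2)

theorem abs_stirlingFirst_sub_le (hn : 3 ≤ n) (hk2 : 2 ≤ k) (hk : k ≤ n) :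
    |(Nat.stirlingFirst n (n - k) : ℝ) - Real.exp (-mu n k) * (boardSize n).choose k|
      ≤ (boardSize n).choose k * D₁ n k := by
  have hr : (3 : ℝ) ≤ n := by exact_mod_cast hn
  have hpos := boardSize_sub_two_pos hn
  have hk2r : (0 : ℝ) ≤ (k : ℝ) - 2 := by
    have : (2 : ℝ) ≤ k := by exact_mod_cast hk2
    linarith
  have hx0 : 0 ≤ 4 / (3 * ((n : ℝ) + 1))
      + ((k : ℝ) - 2) * (4 * ((n : ℝ) - 1) / ((n : ℝ) * (n - 1) - 4)) := by
    have : 0 ≤ (n : ℝ) - 1 := by linarith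
    positivity
  refine abs_sub_le_mul_min (by positivity) (mu_nonneg n k) hx0 (error_le_d₁_or hn hk2 hk) ?_
  intro δ hδ
  obtain ⟨m, rfl⟩ := Nat.exists_eq_add_of_le' hk2
  have h := abs_card_independent_sub_le (V := board n) (E := colPairs n) (m := m) (Δ := n - 2)
    (l := mu n (m + 2)) (δ := δ) (by rw [card_board]; exact three_le_boardSize hn)
    (fun p hp => (mem_colPairs.1 hp).1) (fun a ha => card_colPairs_mem_le ha)
    (by rw [card_board, card_colPairs, mu]) (by
      rw [card_board, card_colPairs, choose_three_div_boardSize hn, div_boardSize_sub_two,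
        Nat.cast_sub (by omega)]
      refine hδ.imp_left fun hδ => le_trans (le_of_eq ?_) hδ
      push_cast
      ring)
  rw [card_board] at h
  rw [← card_placements_stirlingFirst n (m + 2) hk]
  convert h using 6
  ext T
  rw [mem_placements, mem_filter, mem_powersetCard]
  exact and_congr_right fun hT => (forall_colPairs_not_subset hT.1).symm

/-- For `n = k = 3`, where the general error bound is larger than both `d₂` and `1`, the Stirling
number vanishes and `e⁻²` is small enough. -/
theorem abs_stirlingSecond_sub_le_of_three :
    |(Nat.stirlingSecond 3 (3 - 3) : ℝ)
        - Real.exp (-(2 * mu 3 3)) * (boardSize 3).choose 3|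
      ≤ (boardSize 3).choose 3 * D₂ 3 3 := by
  have hb : boardSize 3 = 3 := rfl
  have hmu : mu 3 3 = 1 := by
    norm_num [mu, hb, show Nat.choose 3 2 = 3 from rfl]
  have hd : d₂ 3 3 = 7 / 9 := by
    rw [d₂_eq le_rfl, tau_eq]
    norm_num
  have hD : D₂ 3 3 = 7 / 9 := by
    rw [D₂, hd, hmu]
    norm_num
  have he : Real.exp (-(2 * 1)) ≤ 7 / 9 := by
    have h := Real.add_one_le_exp (2 : ℝ)
    rw [Real.exp_neg, mul_one]
    calc (Real.exp 2)⁻¹ ≤ (2 + 1 : ℝ)⁻¹ := inv_anti₀ (by norm_num) h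
      _ ≤ 7 / 9 := by norm_num
  rw [hD, hmu, hb, Nat.sub_self, Nat.stirlingSecond_succ_zero, Nat.choose_self]
  simp only [Nat.cast_zero, Nat.cast_one, mul_one, one_mul, zero_sub, abs_neg] at he ⊢
  rwa [abs_of_pos (Real.exp_pos _)]

theorem abs_stirlingSecond_sub_le (hn : 3 ≤ n) (hk2 : 2 ≤ k) (hk : k ≤ n) :
    |(Nat.stirlingSecond n (n - k) : ℝ) - Real.exp (-(2 * mu n k)) * (boardSize n).choose k|
      ≤ (boardSize n).choose k * D₂ n k := by
  by_cases h33 : n = 3 ∧ k = 3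
  · obtain ⟨rfl, rfl⟩ := h33
    exact abs_stirlingSecond_sub_le_of_three
  have hr : (3 : ℝ) ≤ n := by exact_mod_cast hn
  have hpos := boardSize_sub_two_pos hn
  have hk2r : (0 : ℝ) ≤ (k : ℝ) - 2 := by
    have : (2 : ℝ) ≤ k := by exact_mod_cast hk2
    linarith
  have hx0 : 0 ≤ 8 / (3 * ((n : ℝ) + 1))
      + ((k : ℝ) - 2) * ((8 * (n : ℝ) - 12) / ((n : ℝ) * (n - 1) - 4)) := by
    have : 0 ≤ 8 * (n : ℝ) - 12 := by linarith
    positivity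
  refine abs_sub_le_mul_min (by positivity) (mul_nonneg zero_le_two (mu_nonneg n k)) hx0
    (error_le_d₂_or hn hk2 hk h33) ?_
  intro δ hδ
  obtain ⟨m, rfl⟩ := Nat.exists_eq_add_of_le' hk2
  have h := abs_card_independent_sub_le (V := board n) (E := colPairs n ∪ rowPairs n) (m := m)
    (Δ := 2 * (n - 2)) (l := 2 * mu n (m + 2)) (δ := δ)
    (by rw [card_board]; exact three_le_boardSize hn)
    (union_subset (fun p hp => (mem_colPairs.1 hp).1) (fun p hp => (mem_rowPairs.1 hp).1))
    (fun a ha => card_colPairs_union_rowPairs_mem_le ha)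
    (by
      rw [card_board, card_colPairs_union_rowPairs, mu]
      push_cast
      ring) (by
      rw [card_board, card_colPairs_union_rowPairs, Nat.cast_mul, mul_div_assoc,
        choose_three_div_boardSize hn, div_boardSize_sub_two, Nat.cast_mul,
        Nat.cast_sub (by omega)]
      refine hδ.imp_left fun hδ => le_trans (le_of_eq ?_) hδ
      push_cast
      ring)
  rw [card_board] at h
  rw [← card_placements_stirlingSecond n (m + 2) hk]
  convert h using 6
  ext T
  rw [mem_placements, mem_filter, mem_powersetCard]
  refine and_congr_right fun hT => ?_
  rw [← forall_colPairs_not_subset hT.1, ← forall_rowPairs_not_subset hT.1]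
  simp only [mem_union, or_imp, forall_and]

theorem choose_boardSize_pos (hn : 3 ≤ n) (hk : k ≤ n) :
    (0 : ℝ) < (boardSize n).choose k := by
  have : n ≤ boardSize n := by
    rw [boardSize, Nat.choose_two_right, Nat.le_div_iff_mul_le two_pos]
    exact Nat.mul_le_mul_left n (by omega)
  exact_mod_cast Nat.choose_pos (hk.trans this)

theorem D₁_nonneg (hn : 3 ≤ n) (hk2 : 2 ≤ k) (hk : k ≤ n) : 0 ≤ D₁ n k := by
  have := (abs_nonneg _).trans (abs_stirlingFirst_sub_le hn hk2 hk)
  exact nonneg_of_mul_nonneg_right this (choose_boardSize_pos hn hk)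

theorem D₂_nonneg (hn : 3 ≤ n) (hk2 : 2 ≤ k) (hk : k ≤ n) : 0 ≤ D₂ n k := by
  have := (abs_nonneg _).trans (abs_stirlingSecond_sub_le hn hk2 hk)
  exact nonneg_of_mul_nonneg_right this (choose_boardSize_pos hn hk)

theorem bounds_of_abs_sub_le {C S l D : ℝ} (h : |S - Real.exp (-l) * C| ≤ C * D) :
    C * Real.exp (-l) * (1 - Real.exp l * D) ≤ S ∧
      S ≤ C * Real.exp (-l) * (1 + Real.exp l * D) := by
  have he : Real.exp (-l) * Real.exp l = 1 := by rw [← Real.exp_add]; simp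
  have h1 : C * Real.exp (-l) * (1 - Real.exp l * D) = Real.exp (-l) * C - C * D := by
    linear_combination (-C * D) * he
  have h2 : C * Real.exp (-l) * (1 + Real.exp l * D) = Real.exp (-l) * C + C * D := by
    linear_combination (C * D) * he
  obtain ⟨h3, h4⟩ := abs_le.1 h
  rw [h1, h2]
  constructor <;> linarith

/-- If `k = O(√n)` then `μ` is bounded, so that an error `0 ≤ D ≤ 30 k / n` tends to `0` even after
multiplication by a fixed power of `e ^ μ`. -/
theorem tendsto_exp_mul_error {D : ℕ → ℕ → ℝ} {k : ℕ → ℕ} {c : ℝ} (hc : 0 ≤ c)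
    (hD0 : ∀ n k, 8 ≤ n → 2 ≤ k → k ≤ n → 0 ≤ D n k)
    (hD : ∀ n k, 8 ≤ n → 2 ≤ k → k ≤ n → D n k ≤ 30 * (k / n))
    (hk : ∀ᶠ n in atTop, 2 ≤ k n ∧ k n ≤ n)
    (hO : (fun n => (k n : ℝ)) =O[atTop] fun n : ℕ => Real.sqrt (n : ℝ)) :
    Tendsto (fun n => Real.exp (c * mu n (k n)) * D n (k n)) atTop (𝓝 0) := by
  obtain ⟨B, hB⟩ := hO.bound
  have hlim : Tendsto (fun n : ℕ => Real.exp (c * B ^ 2) * (30 * B) * (Real.sqrt (n : ℝ))⁻¹)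
      atTop (𝓝 0) := by
    have h := (tendsto_inv_atTop_zero.comp
      (Real.tendsto_sqrt_atTop.comp tendsto_natCast_atTop_atTop)).const_mul
        (Real.exp (c * B ^ 2) * (30 * B))
    rw [mul_zero] at h
    exact h
  refine squeeze_zero' ?_ ?_ hlim
  · filter_upwards [hk, eventually_ge_atTop 8] with n hkn hn
    exact mul_nonneg (Real.exp_pos _).le (hD0 n _ hn hkn.1 hkn.2)
  · filter_upwards [hk, eventually_ge_atTop 8, hB] with n hkn hn hBn
    have hn0 : (0 : ℝ) < n := by exact_mod_cast (by omega : 0 < n)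
    rw [Real.norm_of_nonneg (by positivity), Real.norm_of_nonneg (Real.sqrt_nonneg _)] at hBn
    have hs : Real.sqrt n ^ 2 = n := Real.sq_sqrt hn0.le
    have hs0 : 0 < Real.sqrt n := Real.sqrt_pos.2 hn0
    have hmu : mu n (k n) ≤ B ^ 2 := by
      refine (mu_le_sq_div (by omega)).trans ?_
      rw [div_le_iff₀ hn0]
      calc ((k n : ℝ)) ^ 2 ≤ (B * Real.sqrt n) ^ 2 := pow_le_pow_left₀ (by positivity) hBn 2
        _ = B ^ 2 * n := by rw [mul_pow, hs]
    have hkn' : (k n : ℝ) / n ≤ B * (Real.sqrt n)⁻¹ := by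
      rw [div_le_iff₀ hn0]
      calc (k n : ℝ) ≤ B * Real.sqrt n := hBn
        _ = B * (Real.sqrt n)⁻¹ * Real.sqrt n ^ 2 := by field_simp
        _ = _ := by rw [hs]
    calc Real.exp (c * mu n (k n)) * D n (k n)
        ≤ Real.exp (c * B ^ 2) * (30 * (B * (Real.sqrt n)⁻¹)) := by
          refine mul_le_mul (Real.exp_le_exp.2 (mul_le_mul_of_nonneg_left hmu hc)) ?_
            (hD0 n _ hn hkn.1 hkn.2) (Real.exp_pos _).le
          exact (hD n _ hn hkn.1 hkn.2).trans (by linarith)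
      _ = _ := by ring

end StirlingBound

theorem mainTheorem1 :
    (∀ n k : ℕ, 3 ≤ n → 2 ≤ k → k ≤ n →
      (((StirlingBound.boardSize n).choose k : ℝ) * Real.exp (-(2 * StirlingBound.mu n k))
            * (1 - Real.exp (2 * StirlingBound.mu n k) * StirlingBound.D₂ n k)
          ≤ (Nat.stirlingSecond n (n - k) : ℝ) ∧
        (Nat.stirlingSecond n (n - k) : ℝ)
          ≤ ((StirlingBound.boardSize n).choose k : ℝ) * Real.exp (-(2 * StirlingBound.mu n k))
            * (1 + Real.exp (2 * StirlingBound.mu n k) * StirlingBound.D₂ n k)) ∧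
      (((StirlingBound.boardSize n).choose k : ℝ) * Real.exp (-StirlingBound.mu n k)
            * (1 - Real.exp (StirlingBound.mu n k) * StirlingBound.D₁ n k)
          ≤ ((|StirlingBound.signedStirlingFirst n (n - k)| : ℤ) : ℝ) ∧
        ((|StirlingBound.signedStirlingFirst n (n - k)| : ℤ) : ℝ)
          ≤ ((StirlingBound.boardSize n).choose k : ℝ) * Real.exp (-StirlingBound.mu n k)
            * (1 + Real.exp (StirlingBound.mu n k) * StirlingBound.D₁ n k))) ∧
    (∀ k : ℕ → ℕ, (∀ᶠ n in atTop, 2 ≤ k n ∧ k n ≤ n) →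
      ((fun n => (k n : ℝ)) =O[atTop] fun n : ℕ => Real.sqrt (n : ℝ)) →
      Tendsto (fun n => StirlingBound.D₁ n (k n)) atTop (𝓝 0) ∧
      Tendsto (fun n => StirlingBound.D₂ n (k n)) atTop (𝓝 0) ∧
      Tendsto (fun n => Real.exp (StirlingBound.mu n (k n)) * StirlingBound.D₁ n (k n))
        atTop (𝓝 0) ∧
      Tendsto (fun n => Real.exp (2 * StirlingBound.mu n (k n)) * StirlingBound.D₂ n (k n))
        atTop (𝓝 0))
 := by
  have hD₁0 : ∀ n k, 8 ≤ n → 2 ≤ k → k ≤ n → 0 ≤ StirlingBound.D₁ n k :=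
    fun n k hn hk2 hk => StirlingBound.D₁_nonneg (by omega) hk2 hk
  have hD₂0 : ∀ n k, 8 ≤ n → 2 ≤ k → k ≤ n → 0 ≤ StirlingBound.D₂ n k :=
    fun n k hn hk2 hk => StirlingBound.D₂_nonneg (by omega) hk2 hk
  have hD₁ : ∀ n k : ℕ, 8 ≤ n → 2 ≤ k → k ≤ n → StirlingBound.D₁ n k ≤ 30 * (k / n) :=
    fun n k hn hk2 hk => (min_le_left _ _).trans (StirlingBound.d₁_le_div hn hk2 hk)
  have hD₂ : ∀ n k : ℕ, 8 ≤ n → 2 ≤ k → k ≤ n → StirlingBound.D₂ n k ≤ 30 * (k / n) :=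
    fun n k hn hk2 hk => (min_le_left _ _).trans (StirlingBound.d₂_le_div hn hk2 hk)
  refine ⟨fun n k hn hk2 hk => ⟨?_, ?_⟩, fun k hk hO => ⟨?_, ?_, ?_, ?_⟩⟩
  · exact StirlingBound.bounds_of_abs_sub_le (StirlingBound.abs_stirlingSecond_sub_le hn hk2 hk)
  · rw [StirlingBound.abs_signedStirlingFirst, Int.cast_natCast]
    exact StirlingBound.bounds_of_abs_sub_le (StirlingBound.abs_stirlingFirst_sub_le hn hk2 hk)
  · simpa using StirlingBound.tendsto_exp_mul_error le_rfl hD₁0 hD₁ hk hO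
  · simpa using StirlingBound.tendsto_exp_mul_error le_rfl hD₂0 hD₂ hk hO
  · simpa using StirlingBound.tendsto_exp_mul_error zero_le_one hD₁0 hD₁ hk hO
  · exact StirlingBound.tendsto_exp_mul_error zero_le_two hD₂0 hD₂ hk hO
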